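/- Let $n\ge 2$, let $\Delta_n=\{p\in(0,1)^n:\sum_i p_i=1\}$ be the open unit simplex and $\overline\Delta_n$ the closed unit simplex. A map $\pi:\Delta_n\to\overline\Delta_n$ is functionally generated if there is a concave $\Phi:\Delta_n\to(0,\infty)$ with $\sum_i \pi_i(p)\,q_i/p_i\ge \Phi(q)/\Phi(p)$ for all $p,q\in\Delta_n$; let $\mathcal{FG}$ be the set of all such maps, with the topology of uniform convergence and its Borel $\sigma$-algebra. For a market path $\mu=(\mu(t))_{t\ge0}$ in $\Delta_n$ and a sequence $(w(t))_{t\ge 0}$ of portfolio vectors in $\overline\Delta_n$, the relative value is $V_w(0)=1$, $V_w(t+1)=V_w(t)\sum_i w_i(t)\,\mu_i(t+1)/\mu_i(t)$; for $\pi\in\mathcal{FG}$, $V_\pi$ is the relative value of $(\pi(\mu(t)))_t$. Put $V^*(t)=\sup_{\pi\in\mathcal{FG}}V_\pi(t)$ and $W(\pi)=\lim_{t\to\infty}\frac1t\log V_\pi(t)$. For a Borel probability measure $\nu_0$ on $\mathcal{FG}$, let $\nu_t(B)=\int_B V_\pi(t)\,d\nu_0\big/\int_{\mathcal{FG}} V_\pi(t)\,d\nu_0$,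 and let $\widehat V(t)$ be the relative value of Cover's portfolio $\widehat\pi(t)=\int_{\mathcal{FG}}\pi(\mu(t))\,d\nu_t(\pi)$. The support $\mathrm{supp}(\nu_0)$ is the smallest closed set of $\nu_0$-measure one. Call $(\mu,\mathbb P)$ admissible if there is $M>0$ with $\frac1M\le\mu_i(t+1)/\mu_i(t)\le M$ for all $i,t$, and the empirical measures $\mathbb P_t=\frac1t\sum_{s<t}\delta_{(\mu(s),\mu(s+1))}$ converge weakly to the Borel probability measure $\mathbb P$ on $\Delta_n\times\Delta_n$, which is absolutely continuous with respect to Lebesgue measure on $\Delta_n\times\Delta_n$. (i) For every admissible $(\mu,\mathbb P)$, $W(\pi)$ exists for every $\pi\in\mathcal{FG}$, and $\sup_{\pi\in\mathcal{FG}}\left|\frac1t\log V_\pi(t)-W(\pi)\right|\to0$ as $t\to\infty$. (ii) For every admissible $(\mu,\mathbb P)$ and every Borel probability measure $\nu_0$ on $\mathcal{FG}$ that has a support in the above sense, $W^*_{\nu_0}=\sup_{\mathrm{supp}(\nu_0)}W$ is finite and $(\nu_t)$ satisfies the large deviation principle on $\mathcal{FG}$ with rate $I(\pi)=W^*_{\nu_0}-W(\pi)$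 for $\pi\in\mathrm{supp}(\nu_0)$ and $I(\pi)=\infty$ otherwise; that is, $I:\mathcal{FG}\to[0,\infty]$ is lower semicontinuous, $\limsup_{t\to\infty}\frac1t\log\nu_t(F)\le-\inf_F I$ for every closed $F$, and $\liminf_{t\to\infty}\frac1t\log\nu_t(G)\ge-\inf_G I$ for every open $G$. (iii) There is a probability measure $\nu_0=\sum_{k}\lambda_k\delta_{\pi_k}$ on $\mathcal{FG}$ with countably many atoms ($\pi_k\in\mathcal{FG}$, $\lambda_k>0$, $\sum_k\lambda_k=1$), which has a support and depends only on $n$, such that for every admissible $(\mu,\mathbb P)$: $\sup_{\mathrm{supp}(\nu_0)}W=\sup_{\mathcal{FG}}W=:W^*$ (finite), $\widehat\pi(t)\in\overline\Delta_n$ and $V^*(t)<\infty$ for all $t$, and $$\lim_{t\to\infty}\tfrac1t\log\widehat V(t)=\lim_{t\to\infty}\tfrac1t\log V^*(t)=W^*,\qquad \lim_{t\to\infty}\tfrac1t\log\frac{\widehat V(t)}{V^*(t)}=0 .$$ -/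

import Mathlib

open Set Filter Topology MeasureTheory
open scoped ENNReal NNReal UniformConvergence

noncomputable section

namespace UniversalPortfolio

/-- The open unit simplex `Δ_n` of strictly positive weight vectors. -/
def openSimplex (n : ℕ) : Set (Fin n → ℝ) :=
  {p | (∀ i, 0 < p i) ∧ ∑ i, p i = 1}

/-- The coordinates `(p_1, …, p_{n-1})` on `Δ_n`; the remaining weight is `1 - ∑_{i<n} p_i`. -/
def simplexChart (n : ℕ) (p : openSimplex n) : Fin (n - 1) → ℝ :=
  fun i => p.1 (Fin.castLE (Nat.sub_le n 1) i)

/-- Lebesgue measure on the `(n-1)`-dimensional open simplex `Δ_n`. -/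
def simplexVolume (n : ℕ) : Measure (openSimplex n) :=
  Measure.comap (simplexChart n) volume

theorem measurableSet_openSimplex (n : ℕ) : MeasurableSet (openSimplex n) := by
  have h : openSimplex n = (⋂ i, {p | 0 < p i}) ∩ {p | ∑ i, p i = 1} := by
    ext p; simp [openSimplex]
  rw [h]
  exact (MeasurableSet.iInter fun i =>
      measurableSet_lt measurable_const (measurable_pi_apply i)).inter
    (measurableSet_eq_fun (Finset.measurable_sum _ fun i _ => measurable_pi_apply i)
      measurable_const)

/-- The chart is a measurable embedding, so pulling Lebesgue measure back along it is legitimate. -/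
theorem measurableEmbedding_simplexChart (n : ℕ) : MeasurableEmbedding (simplexChart n) := by
  have : StandardBorelSpace (openSimplex n) := (measurableSet_openSimplex n).standardBorel
  have hc : Continuous (simplexChart n) := by
    exact continuous_pi fun i => (continuous_apply _).comp continuous_subtype_val
  refine hc.measurable.measurableEmbedding ?_
  rintro ⟨p, hp, hps⟩ ⟨q, hq, hqs⟩ h
  have h' : ∀ i : Fin (n - 1),
      p (Fin.castLE (Nat.sub_le n 1) i) = q (Fin.castLE (Nat.sub_le n 1) i) :=
    fun i => congrFun h i
  cases n with
  | zero => simp at hps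
  | succ m =>
    have hcast : ∀ i : Fin m, p i.castSucc = q i.castSucc := fun i => h' i
    rw [Fin.sum_univ_castSucc] at hps hqs
    apply Subtype.ext
    funext i
    refine Fin.lastCases ?_ hcast i
    simp only [hcast] at hps
    linarith

instance (n : ℕ) : SigmaFinite (simplexVolume n) :=
  ⟨⟨{ set := fun k => simplexChart n ⁻¹' spanningSets volume k
      set_mem := fun _ => trivial
      finite := fun k => by
        rw [simplexVolume, (measurableEmbedding_simplexChart n).comap_apply]
        exact (measure_mono (image_preimage_subset _ _)).trans_lt
          (measure_spanningSets_lt_top volume k)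
      spanning := by rw [← preimage_iUnion, iUnion_spanningSets, preimage_univ] }⟩⟩

/-- Bounded relative returns: for some `M > 0`, `1/M ≤ μ_i(t+1)/μ_i(t) ≤ M` for all `i, t`. -/
def BoundedReturns {n : ℕ} (μ : ℕ → openSimplex n) : Prop :=
  ∃ M : ℝ, 0 < M ∧ ∀ (t : ℕ) (i : Fin n),
    1 / M ≤ (μ (t + 1)).1 i / (μ t).1 i ∧ (μ (t + 1)).1 i / (μ t).1 i ≤ M

/-- The empirical measure `P_t = (1/t) ∑_{s<t} δ_{(μ(s), μ(s+1))}` (the zero measure for `t = 0`).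
For `t ≥ 1` it is a probability measure. -/
def empiricalMeasure {n : ℕ} (μ : ℕ → openSimplex n) (t : ℕ) :
    FiniteMeasure (openSimplex n × openSimplex n) :=
  ⟨((t : ℝ≥0)⁻¹) • ∑ s ∈ Finset.range t, Measure.dirac (μ s, μ (s + 1)), inferInstance⟩

/-- The market path has bounded relative returns, and its empirical pair measures converge weakly
to the probability measure `P`, which is absolutely continuous on `Δ_n × Δ_n`. -/
structure IsStableMarket {n : ℕ} (μ : ℕ → openSimplex n)
    (P : ProbabilityMeasure (openSimplex n × openSimplex n)) : Prop where
  bounded : BoundedReturns μ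
  absolutelyContinuous :
    (P : Measure (openSimplex n × openSimplex n)) ≪ (simplexVolume n).prod (simplexVolume n)
  tendsto : Tendsto (empiricalMeasure μ) atTop (𝓝 P.toFiniteMeasure)

/-- Portfolio maps `Δ_n → closed simplex`, with the topology of uniform convergence. -/
abbrev PortfolioMap (n : ℕ) : Type := openSimplex n →ᵤ stdSimplex ℝ (Fin n)

/-- The portfolio vector `π(p)`. -/
def PortfolioMap.weights {n : ℕ} (π : PortfolioMap n) (p : openSimplex n) : Fin n → ℝ :=
  (UniformFun.toFun π p).1

/-- `π` is functionally generated: there is a positive concave `Φ` on `Δ_n` with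
`∑ π_i(p) q_i / p_i ≥ Φ(q) / Φ(p)` for all `p, q ∈ Δ_n`. -/
def IsFunctionallyGenerated {n : ℕ} (π : PortfolioMap n) : Prop :=
  ∃ Φ : (Fin n → ℝ) → ℝ, ConcaveOn ℝ (openSimplex n) Φ ∧ (∀ p ∈ openSimplex n, 0 < Φ p) ∧
    ∀ p q : openSimplex n, Φ q.1 / Φ p.1 ≤ ∑ i, π.weights p i * (q.1 i / p.1 i)

/-- The family of functionally generated portfolios, with the topology of uniform convergence
(inherited from `PortfolioMap n`). -/
abbrev FG (n : ℕ) : Type := {π : PortfolioMap n // IsFunctionallyGenerated π}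

instance (n : ℕ) : MeasurableSpace (FG n) := borel (FG n)

instance (n : ℕ) : BorelSpace (FG n) := ⟨rfl⟩

/-- The relative value of a sequence of portfolio vectors with respect to the market portfolio. -/
def relativeValue {n : ℕ} (μ : ℕ → openSimplex n) (w : ℕ → Fin n → ℝ) : ℕ → ℝ
  | 0 => 1
  | t + 1 => relativeValue μ w t * ∑ i, w t i * ((μ (t + 1)).1 i / (μ t).1 i)

/-- The relative value `V_π(t)` of a functionally generated portfolio. -/
def value {n : ℕ} (μ : ℕ → openSimplex n) (π : FG n) (t : ℕ) : ℝ :=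
  relativeValue μ (fun s => π.1.weights (μ s)) t

/-- `(1/t) log V_π(t)`. -/
def logGrowth {n : ℕ} (μ : ℕ → openSimplex n) (t : ℕ) (π : FG n) : ℝ :=
  (1 / (t : ℝ)) * Real.log (value μ π t)

/-- The asymptotic growth rate `W(π) = lim (1/t) log V_π(t)` (meaningful if the limit exists). -/
def growthRate {n : ℕ} (μ : ℕ → openSimplex n) (π : FG n) : ℝ :=
  limUnder atTop (fun t => logGrowth μ t π)

/-- The best performance `V*(t)` in the family. -/
def bestValue {n : ℕ} (μ : ℕ → openSimplex n) (t : ℕ) : ℝ :=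
  ⨆ π : FG n, value μ π t

/-- The wealth distribution `ν_t(B) = (∫ V_π(t) dν₀)⁻¹ ∫_B V_π(t) dν₀`. -/
def wealthDistribution {n : ℕ} (μ : ℕ → openSimplex n) (ν₀ : Measure (FG n)) (t : ℕ) :
    Measure (FG n) :=
  (∫⁻ π, ENNReal.ofReal (value μ π t) ∂ν₀)⁻¹ •
    ν₀.withDensity (fun π => ENNReal.ofReal (value μ π t))

/-- Cover's portfolio `π̂(t) = ∫ π(μ(t)) dν_t(π)`. -/
def coverPortfolio {n : ℕ} (μ : ℕ → openSimplex n) (ν₀ : Measure (FG n)) (t : ℕ) : Fin n → ℝ :=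
  ∫ π, π.1.weights (μ t) ∂(wealthDistribution μ ν₀ t)

/-- `S` is the support of `ν`: the smallest closed set of measure one. -/
def IsSupport {Θ : Type*} [TopologicalSpace Θ] [MeasurableSpace Θ] (ν : Measure Θ) (S : Set Θ) :
    Prop :=
  IsLeast {F : Set Θ | IsClosed F ∧ ν F = 1} S

/-- The large deviation principle for the sequence `ν_t` with rate function `I : Θ → [0, ∞]`. -/
structure SatisfiesLDP {Θ : Type*} [TopologicalSpace Θ] [MeasurableSpace Θ]
    (ν : ℕ → Measure Θ) (I : Θ → EReal) : Prop where
  nonneg : ∀ θ, 0 ≤ I θ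
  lowerSemicontinuous : LowerSemicontinuous I
  upper : ∀ F : Set Θ, IsClosed F →
    limsup (fun t : ℕ => ENNReal.log (ν t F) / (t : EReal)) atTop ≤ -⨅ θ ∈ F, I θ
  lower : ∀ G : Set Θ, IsOpen G →
    -⨅ θ ∈ G, I θ ≤ liminf (fun t : ℕ => ENNReal.log (ν t G) / (t : EReal)) atTop

open Classical in
/-- The function equal to `w - W(π)` on `S` and to `∞` off `S`. -/
def deviationRate {Θ : Type*} (W : Θ → ℝ) (w : ℝ) (S : Set Θ) (θ : Θ) : EReal :=
  if θ ∈ S then ((w - W θ : ℝ) : EReal) else ⊤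

end UniversalPortfolio

end

noncomputable section

namespace UniversalPortfolio

variable {n : ℕ}

/-! The uniform topology on portfolio maps is not used as a source of compactness; that comes from
the generating functions. Writing the generator as `exp φ` with `φ o = 0`, the supporting inequality
makes all such `φ` equicontinuous and pointwise bounded, so they form a compact set in
`C(openSimplex n, ℝ)` (`isCompact_logGenerators`).

A generator does not determine its portfolio map, but nearly does for the purpose of averaging.
Applying the supporting inequality at `p + s (q - p)` for small `s` of either sign squeezes the
payoff between one-sided difference quotients of `exp φ`, which depend only on `φ` and are
continuous in `(φ, p, q)`. By Rademacher's theorem `φ` is differentiable almost everywhere, so as `s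
→ 0` the two bounds merge `P`-almost everywhere; this is where absolute continuity of `P` enters.
Hence, near any `φ₀`, all log returns lie within `e` of one `f`, where `f` and `e` are bounded
continuous and `∫ e` is small (`Generates.exists_bracket`). Weak convergence applied to `f` and `e`
traps the average log returns, uniformly near `φ₀` (`IsStableMarket.exists_nhds_logGrowth`), and
compactness makes the averages uniformly Cauchy over the whole family. This is (i).

Consequently the limit `W` is continuous and `V_π(t)` lies between `exp (t (W π ± ε))` uniformly in
`π`. Laplace's method then yields the large deviation principle (`IsStableMarket.satisfiesLDP`).
Cover's wealth telescopes to `∫ V_π(t) dν₀` (`relativeValue_coverPortfolio`), so its rate is the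
supremum of `W` over the support. For (iii), `C(openSimplex n, ℝ)` is second countable: portfolios
whose generators are dense among all chosen generators approximate every growth rate, in every
stable market at once (`exists_dense_growthRate`). -/

/-- The relative return `∑ w_i q_i / p_i` of the portfolio vector `w` when the market moves from
`p` to `q`. -/
def payoff (w : Fin n → ℝ) (p q : openSimplex n) : ℝ := ∑ i, w i * (q.1 i / p.1 i)

/-- `φ` is the logarithm of a generating function of the portfolio map `π`. -/
def Generates (φ : openSimplex n → ℝ) (π : openSimplex n → stdSimplex ℝ (Fin n)) : Prop :=
  ∀ p q, Real.exp (φ q - φ p) ≤ payoff (π p).1 p q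

/-- The log-generating functions which vanish at `o`. -/
def logGenerators (o : openSimplex n) : Set C(openSimplex n, ℝ) :=
  {φ | φ o = 0 ∧ ∃ π, Generates φ π}

/-! ### Payoff bounds and compactness of the log-generators -/

theorem payoff_le {w : Fin n → ℝ} (hw : w ∈ stdSimplex ℝ (Fin n)) {p q : openSimplex n} {r : ℝ}
    (h : ∀ i, q.1 i ≤ r * p.1 i) : payoff w p q ≤ r := by
  calc payoff w p q ≤ ∑ i, w i * r := by
        refine Finset.sum_le_sum fun i _ => mul_le_mul_of_nonneg_left ?_ (hw.1 i)
        exact (div_le_iff₀ (p.2.1 i)).2 (h i)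
    _ = r := by rw [← Finset.sum_mul, hw.2, one_mul]

theorem le_payoff {w : Fin n → ℝ} (hw : w ∈ stdSimplex ℝ (Fin n)) {p q : openSimplex n} {r : ℝ}
    (h : ∀ i, r * p.1 i ≤ q.1 i) : r ≤ payoff w p q := by
  calc r = ∑ i, w i * r := by rw [← Finset.sum_mul, hw.2, one_mul]
    _ ≤ payoff w p q := by
        refine Finset.sum_le_sum fun i _ => mul_le_mul_of_nonneg_left ?_ (hw.1 i)
        exact (le_div_iff₀ (p.2.1 i)).2 (h i)

theorem payoff_le_sum {w : Fin n → ℝ} (hw : w ∈ stdSimplex ℝ (Fin n)) (p q : openSimplex n) :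
    payoff w p q ≤ ∑ i, q.1 i / p.1 i := by
  refine Finset.sum_le_sum fun i _ => ?_
  have h1 : w i ≤ 1 := by
    rw [← hw.2]; exact Finset.single_le_sum (fun j _ => hw.1 j) (Finset.mem_univ i)
  exact mul_le_of_le_one_left (div_pos (q.2.1 i) (p.2.1 i)).le h1

theorem Generates.sub_le_log {φ : openSimplex n → ℝ} {π : openSimplex n → stdSimplex ℝ (Fin n)}
    (h : Generates φ π) {p q : openSimplex n} {r : ℝ} (hr : 0 < r) (hq : ∀ i, q.1 i ≤ r * p.1 i) :
    φ q - φ p ≤ Real.log r :=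
  (Real.le_log_iff_exp_le hr).2 ((h p q).trans (payoff_le (π p).2 hq))

theorem eventually_ratio_le (p : openSimplex n) {r : ℝ} (hr : 1 < r) :
    ∀ᶠ q : openSimplex n in 𝓝 p, ∀ i, q.1 i ≤ r * p.1 i ∧ p.1 i ≤ r * q.1 i := by
  refine eventually_all.2 fun i => ?_
  have hc : Continuous fun q : openSimplex n => q.1 i :=
    (continuous_apply i).comp continuous_subtype_val
  have hp := p.2.1 i
  have h1 : ∀ᶠ q : openSimplex n in 𝓝 p, q.1 i < r * p.1 i :=
    hc.continuousAt.eventually (gt_mem_nhds (by nlinarith))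
  have h2 : ∀ᶠ q : openSimplex n in 𝓝 p, p.1 i < r * q.1 i :=
    (hc.const_mul r).continuousAt.eventually (lt_mem_nhds (by simp only; nlinarith))
  filter_upwards [h1, h2] with q h1 h2 using ⟨h1.le, h2.le⟩

/-- The neighbourhood is cut out by ratios `q_i / p_i` alone and so serves every `φ` at once: this
is equicontinuity. -/
theorem eventually_abs_sub_le (p : openSimplex n) {ε : ℝ} (hε : 0 < ε) :
    ∀ᶠ q : openSimplex n in 𝓝 p, ∀ (φ : openSimplex n → ℝ)
      (π : openSimplex n → stdSimplex ℝ (Fin n)), Generates φ π → |φ q - φ p| ≤ ε := by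
  filter_upwards [eventually_ratio_le p (Real.one_lt_exp_iff.2 hε)] with q hq φ π h
  have h1 := h.sub_le_log (Real.exp_pos ε) fun i => (hq i).1
  have h2 := h.sub_le_log (Real.exp_pos ε) fun i => (hq i).2
  rw [Real.log_exp] at h1 h2
  exact abs_le.2 ⟨by linarith, h1⟩

theorem Generates.continuous {φ : openSimplex n → ℝ}
    {π : openSimplex n → stdSimplex ℝ (Fin n)} (h : Generates φ π) : Continuous φ := by
  refine continuous_iff_continuousAt.2 fun p => Metric.tendsto_nhds.2 fun ε hε => ?_
  filter_upwards [eventually_abs_sub_le p (half_pos hε)] with q hq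
  rw [Real.dist_eq]
  linarith [hq φ π h]

/-- Arzelà–Ascoli needs compactness for pointwise convergence. Carrying the portfolio map along as a
witness turns the existential into a closed condition on pairs `(φ, π)`; these lie in a product of
compact sets by Tychonoff, and projecting to `φ` preserves compactness. -/
theorem isCompact_logGenerators (o : openSimplex n) : IsCompact (logGenerators o) := by
  refine ArzelaAscoli.isCompact_of_equicontinuous _ ?_ ?_
  · let Z : Set ((openSimplex n → ℝ) × (openSimplex n → stdSimplex ℝ (Fin n))) :=
      {z | z.1 o = 0 ∧ Generates z.1 z.2}
    have hZc : IsClosed Z := by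
      refine IsClosed.inter (isClosed_eq (by fun_prop) continuous_const) ?_
      have : {z : (openSimplex n → ℝ) × (openSimplex n → stdSimplex ℝ (Fin n)) |
          Generates z.1 z.2} = ⋂ p, ⋂ q, {z | Real.exp (z.1 q - z.1 p) ≤
            payoff (z.2 p).1 p q} := by
        ext z; simp [Generates]
      change IsClosed {z : (openSimplex n → ℝ) × (openSimplex n → stdSimplex ℝ (Fin n)) |
          Generates z.1 z.2}
      rw [this]
      refine isClosed_iInter fun p => isClosed_iInter fun q => isClosed_le (by fun_prop) ?_
      refine continuous_finsetSum _ fun i _ => Continuous.mul_const ?_ _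
      exact (continuous_apply i).comp
        (continuous_subtype_val.comp ((continuous_apply p).comp continuous_snd))
    let B : openSimplex n → openSimplex n → ℝ := fun p q => Real.log (∑ i, q.1 i / p.1 i)
    have hB : ∀ {φ : openSimplex n → ℝ} {π}, Generates φ π → ∀ p q, φ q - φ p ≤ B p q := by
      intro φ π h p q
      have h1 := (h p q).trans (payoff_le_sum (π p).2 p q)
      exact (Real.le_log_iff_exp_le ((Real.exp_pos _).trans_le h1)).2 h1
    have hZ : IsCompact Z := by
      refine ((isCompact_univ_pi fun p => isCompact_Icc (a := - B p o) (b := B o p)).prod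
        isCompact_univ).of_isClosed_subset hZc ?_
      rintro ⟨φ, π⟩ ⟨h0, h⟩
      refine ⟨fun p _ => ?_, trivial⟩
      have h1 := hB h o p
      have h2 := hB h p o
      simp only at h0 h1 h2
      rw [h0] at h1 h2
      exact ⟨by simp only; linarith, by simp only; linarith⟩
    convert hZ.image continuous_fst using 1
    ext φ
    constructor
    · rintro ⟨f, ⟨h0, π, h⟩, rfl⟩
      exact ⟨(f, π), ⟨h0, h⟩, rfl⟩
    · rintro ⟨⟨f, π⟩, ⟨h0, h⟩, rfl⟩
      exact ⟨⟨f, h.continuous⟩, ⟨h0, π, h⟩, rfl⟩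
  · intro p
    rw [Metric.equicontinuousAt_iff_right]
    intro ε hε
    filter_upwards [eventually_abs_sub_le p (half_pos hε)] with q hq φ
    obtain ⟨-, π, h⟩ := φ.2
    rw [dist_comm, Real.dist_eq]
    linarith [hq _ π h]

/-- The portfolio map, as a plain function. -/
def FG.map (π : FG n) : openSimplex n → stdSimplex ℝ (Fin n) := UniformFun.toFun π.1

/-- Concavity of `Φ` is dropped: the inequality already presents `Φ` as an infimum of affine
functions. -/
theorem FG.exists_logGenerator (π : FG n) (o : openSimplex n) :
    ∃ φ ∈ logGenerators o, Generates φ π.map := by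
  obtain ⟨Φ, -, hpos, h⟩ := π.2
  let φ : openSimplex n → ℝ := fun p => Real.log (Φ p.1) - Real.log (Φ o.1)
  have hφ : Generates φ π.map := by
    intro p q
    have hp := hpos p.1 p.2
    have hq := hpos q.1 q.2
    have : φ q - φ p = Real.log (Φ q.1) - Real.log (Φ p.1) := by simp [φ]
    rw [this, Real.exp_sub, Real.exp_log hp, Real.exp_log hq]
    exact h p q
  exact ⟨⟨φ, hφ.continuous⟩, ⟨by simp [φ], _, hφ⟩, hφ⟩

/-! ### Difference quotients of the generator as bounds on the payoff -/

/-- The pairs `(p, q)` with all ratios `q_i / p_i` between `1 / M` and `M`. -/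
def boundedPairs (n : ℕ) (M : ℝ) : Set (openSimplex n × openSimplex n) :=
  {x | ∀ i, x.1.1 i ≤ M * x.2.1 i ∧ x.2.1 i ≤ M * x.1.1 i}

theorem isClosed_boundedPairs (M : ℝ) : IsClosed (boundedPairs n M) := by
  have : boundedPairs n M = ⋂ i, ({x | x.1.1 i ≤ M * x.2.1 i} ∩ {x | x.2.1 i ≤ M * x.1.1 i}) := by
    ext x; simp [boundedPairs]
  rw [this]
  have h1 : ∀ i, Continuous fun x : openSimplex n × openSimplex n => x.1.1 i := fun i =>
    (continuous_apply i).comp (continuous_subtype_val.comp continuous_fst)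
  have h2 : ∀ i, Continuous fun x : openSimplex n × openSimplex n => x.2.1 i := fun i =>
    (continuous_apply i).comp (continuous_subtype_val.comp continuous_snd)
  exact isClosed_iInter fun i => (isClosed_le (h1 i) ((h2 i).const_mul M)).inter
    (isClosed_le (h2 i) ((h1 i).const_mul M))

theorem payoff_mem_Icc {M : ℝ} (hM : 0 < M) {x : openSimplex n × openSimplex n}
    (hx : x ∈ boundedPairs n M) {w : Fin n → ℝ} (hw : w ∈ stdSimplex ℝ (Fin n)) :
    payoff w x.1 x.2 ∈ Icc M⁻¹ M :=
  ⟨le_payoff hw fun i => (inv_mul_le_iff₀ hM).2 (hx i).1, payoff_le hw fun i => (hx i).2⟩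

open Classical in
/-- The point `p + s (q - p)`, if it lies in the open simplex. -/
def slide (x : openSimplex n × openSimplex n) (s : ℝ) : openSimplex n :=
  if h : (fun i => x.1.1 i + s * (x.2.1 i - x.1.1 i)) ∈ openSimplex n then ⟨_, h⟩ else x.1

theorem slide_val {x : openSimplex n × openSimplex n} {s : ℝ}
    (h : ∀ i, 0 < x.1.1 i + s * (x.2.1 i - x.1.1 i)) :
    (slide x s).1 = fun i => x.1.1 i + s * (x.2.1 i - x.1.1 i) := by
  have h' : (fun i => x.1.1 i + s * (x.2.1 i - x.1.1 i)) ∈ openSimplex n := by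
    refine ⟨h, ?_⟩
    rw [Finset.sum_add_distrib, ← Finset.mul_sum, Finset.sum_sub_distrib, x.1.2.2, x.2.2.2]
    ring
  rw [slide, dif_pos h']

/-- For `s < 0` the line is followed backwards from `p`, away from `q`; it stays in the simplex
because `q_i ≤ M p_i`. -/
theorem slide_pos {M : ℝ} {x : openSimplex n × openSimplex n}
    (hx : x ∈ boundedPairs n M) {s : ℝ} (hs : |s| * M < 1) (hM : 1 ≤ M) (i : Fin n) :
    0 < x.1.1 i + s * (x.2.1 i - x.1.1 i) := by
  have hp := x.1.2.1 i
  have hq := x.2.2.1 i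
  have hqM := (hx i).2
  rcases le_total 0 s with h | h
  · rw [abs_of_nonneg h] at hs
    have : s < 1 := by nlinarith
    nlinarith [mul_nonneg h hq.le, mul_pos (sub_pos.2 this) hp]
  · rw [abs_of_nonpos h] at hs
    nlinarith [mul_le_mul_of_nonneg_left hqM (neg_nonneg.2 h), mul_pos (sub_pos.2 hs) hp,
      mul_nonneg (neg_nonneg.2 h) hp.le]

/-- The payoff is affine in its target and equals `1` when the target is `p`. -/
theorem payoff_slide {x : openSimplex n × openSimplex n} {s : ℝ}
    (h : ∀ i, 0 < x.1.1 i + s * (x.2.1 i - x.1.1 i)) {w : Fin n → ℝ}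
    (hw : w ∈ stdSimplex ℝ (Fin n)) :
    payoff w x.1 (slide x s) = 1 + s * (payoff w x.1 x.2 - 1) := by
  have : ∀ i, w i * ((slide x s).1 i / x.1.1 i) =
      (1 - s) * w i + s * (w i * (x.2.1 i / x.1.1 i)) := by
    intro i
    have hp := (x.1.2.1 i).ne'
    rw [slide_val h]
    field_simp
    ring
  simp only [payoff, this, Finset.sum_add_distrib, ← Finset.mul_sum, hw.2]
  ring

theorem slide_zero (x : openSimplex n × openSimplex n) : slide x 0 = x.1 := by
  apply Subtype.ext
  rw [slide_val (by simpa using x.1.2.1)]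
  simp

theorem continuous_slide {M : ℝ} (hM : 1 ≤ M) {s : ℝ} (hs : |s| * M < 1) :
    Continuous fun x : boundedPairs n M => slide x.1 s := by
  refine continuous_induced_rng.2 ?_
  have : (Subtype.val ∘ fun x : boundedPairs n M => slide x.1 s) =
      fun x i => x.1.1.1 i + s * (x.1.2.1 i - x.1.1.1 i) :=
    funext fun x => slide_val (slide_pos x.2 hs hM)
  rw [this]
  refine continuous_pi fun i => ?_
  have h1 : Continuous fun x : boundedPairs n M => x.1.1.1 i := (continuous_apply i).comp
    (continuous_subtype_val.comp (continuous_fst.comp continuous_subtype_val))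
  have h2 : Continuous fun x : boundedPairs n M => x.1.2.1 i := (continuous_apply i).comp
    (continuous_subtype_val.comp (continuous_snd.comp continuous_subtype_val))
  exact h1.add ((h2.sub h1).const_mul s)

/-- Difference quotient at `p` of `exp φ / exp φ(p)` in the direction `q - p`. -/
def expSlope (φ : openSimplex n → ℝ) (x : openSimplex n × openSimplex n) (s : ℝ) : ℝ :=
  (Real.exp (φ (slide x s) - φ x.1) - 1) / s

theorem Generates.expSlope_le {φ : openSimplex n → ℝ}
    {π : openSimplex n → stdSimplex ℝ (Fin n)} (h : Generates φ π)
    {x : openSimplex n × openSimplex n} {s : ℝ} (hs : 0 < s)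
    (hx : ∀ i, 0 < x.1.1 i + s * (x.2.1 i - x.1.1 i)) :
    1 + expSlope φ x s ≤ payoff (π x.1).1 x.1 x.2 := by
  have h1 := h x.1 (slide x s)
  rw [payoff_slide hx (π x.1).2] at h1
  have : expSlope φ x s ≤ payoff (π x.1).1 x.1 x.2 - 1 := by
    rw [expSlope, div_le_iff₀ hs]; linarith
  linarith

/-- The same supporting inequality as for `s > 0`; dividing by a negative `s` turns it into an upper
bound. -/
theorem Generates.le_expSlope {φ : openSimplex n → ℝ}
    {π : openSimplex n → stdSimplex ℝ (Fin n)} (h : Generates φ π)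
    {x : openSimplex n × openSimplex n} {s : ℝ} (hs : s < 0)
    (hx : ∀ i, 0 < x.1.1 i + s * (x.2.1 i - x.1.1 i)) :
    payoff (π x.1).1 x.1 x.2 ≤ 1 + expSlope φ x s := by
  have h1 := h x.1 (slide x s)
  rw [payoff_slide hx (π x.1).2] at h1
  have : payoff (π x.1).1 x.1 x.2 - 1 ≤ expSlope φ x s := by
    rw [expSlope, le_div_iff_of_neg hs]; linarith
  linarith

/-- The logarithm of `y` truncated to `[1 / M, M]`. -/
def clampLog (M y : ℝ) : ℝ := Real.log (max M⁻¹ (min y M))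

theorem continuous_clampLog {M : ℝ} (hM : 0 < M) : Continuous (clampLog M) := by
  unfold clampLog
  refine Continuous.log (by fun_prop) fun y => ?_
  exact ((inv_pos.2 hM).trans_le (le_max_left _ _)).ne'

theorem clampLog_mono {M : ℝ} (hM : 0 < M) : Monotone (clampLog M) := fun y z h =>
  Real.log_le_log ((inv_pos.2 hM).trans_le (le_max_left _ _)) (by gcongr)

theorem clampLog_of_mem {M y : ℝ} (h : y ∈ Icc M⁻¹ M) : clampLog M y = Real.log y := by
  rw [clampLog, min_eq_left h.2, max_eq_right h.1]

theorem abs_clampLog_le {M : ℝ} (hM : 1 ≤ M) (y : ℝ) : |clampLog M y| ≤ Real.log M := by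
  have h0 : 0 < M := by linarith
  have h1 := clampLog_mono h0 (min_le_left y M)
  have hi : M⁻¹ ≤ M := (inv_le_one_of_one_le₀ hM).trans hM
  rw [clampLog, abs_le, ← Real.log_inv]
  refine ⟨Real.log_le_log (inv_pos.2 h0) (le_max_left _ _),
    Real.log_le_log ((inv_pos.2 h0).trans_le (le_max_left _ _)) ?_⟩
  exact max_le hi (min_le_right _ _)

/-! ### Almost everywhere differentiability of log-generators -/

/-- The inverse of the chart of the simplex: append the remaining weight. -/
def appendWeight {m : ℕ} (x : Fin m → ℝ) : Fin (m + 1) → ℝ := Fin.snoc x (1 - ∑ i, x i)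

theorem continuous_appendWeight_apply {m : ℕ} (j : Fin (m + 1)) :
    Continuous fun x : Fin m → ℝ => appendWeight x j := by
  refine Fin.lastCases ?_ (fun i => ?_) j
  · simp only [appendWeight, Fin.snoc_last]; fun_prop
  · simp only [appendWeight, Fin.snoc_castSucc]; fun_prop

theorem sum_appendWeight {m : ℕ} (x : Fin m → ℝ) : ∑ j, appendWeight x j = 1 := by
  simp [appendWeight, Fin.sum_univ_castSucc]

theorem abs_appendWeight_sub_le {m : ℕ} (x y : Fin m → ℝ) (j : Fin (m + 1)) :
    |appendWeight x j - appendWeight y j| ≤ (m + 1) * dist x y := by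
  have hd : 0 ≤ dist x y := dist_nonneg
  have hi : ∀ i, |x i - y i| ≤ dist x y := fun i => by
    rw [← Real.dist_eq]; exact dist_le_pi_dist x y i
  refine Fin.lastCases ?_ (fun i => ?_) j
  · simp only [appendWeight, Fin.snoc_last]
    have : (1 - ∑ i, x i) - (1 - ∑ i, y i) = -∑ i, (x i - y i) := by
      rw [Finset.sum_sub_distrib]; ring
    rw [this, abs_neg]
    calc |∑ i, (x i - y i)| ≤ ∑ i, |x i - y i| := Finset.abs_sum_le_sum_abs _ _
      _ ≤ ∑ _i : Fin m, dist x y := Finset.sum_le_sum fun i _ => hi i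
      _ = m * dist x y := by simp
      _ ≤ (m + 1) * dist x y := by nlinarith
  · simp only [appendWeight, Fin.snoc_castSucc]
    have : (0 : ℝ) ≤ m := Nat.cast_nonneg m
    nlinarith [hi i, mul_nonneg this hd]

theorem appendWeight_line {m : ℕ} (p q : openSimplex (m + 1)) (s : ℝ) :
    appendWeight (m := m) (simplexChart (m + 1) p +
      s • (simplexChart (m + 1) q - simplexChart (m + 1) p)) =
      fun i => p.1 i + s * (q.1 i - p.1 i) := by
  funext (j : Fin (m + 1))
  refine Fin.lastCases ?_ (fun i => ?_) j
  · have hp := p.2.2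
    have hq := q.2.2
    rw [Fin.sum_univ_castSucc] at hp hq
    simp only [appendWeight, Fin.snoc_last]
    change 1 - ∑ i : Fin m, (p.1 i.castSucc + s * (q.1 i.castSucc - p.1 i.castSucc)) = _
    rw [Finset.sum_add_distrib, ← Finset.mul_sum, Finset.sum_sub_distrib]
    rw [← eq_sub_iff_add_eq'] at hp hq
    rw [hp, hq]
    ring
  · simp only [appendWeight]
    rw [Fin.snoc_castSucc]
    rfl

open Classical in
/-- A function on the open simplex in the coordinates of the chart, extended by `0`. -/
def inChart {m : ℕ} (φ : openSimplex (m + 1) → ℝ) (x : Fin m → ℝ) : ℝ :=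
  if h : appendWeight x ∈ openSimplex (m + 1) then φ ⟨_, h⟩ else 0

/-- The points of the chart all of whose weights are more than `1 / (k + 1)`. -/
def chartInterior (m k : ℕ) : Set (Fin m → ℝ) := {x | ∀ j, 1 / ((k : ℝ) + 1) < appendWeight x j}

theorem isOpen_chartInterior (m k : ℕ) : IsOpen (chartInterior m k) := by
  have : chartInterior m k = ⋂ j, {x | 1 / ((k : ℝ) + 1) < appendWeight x j} := by
    ext x; simp [chartInterior]
  rw [this]
  exact isOpen_iInter_of_finite fun j =>
    isOpen_lt continuous_const (continuous_appendWeight_apply j)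

theorem appendWeight_mem {m k : ℕ} {x : Fin m → ℝ} (hx : x ∈ chartInterior m k) :
    appendWeight x ∈ openSimplex (m + 1) :=
  ⟨fun j => lt_trans (by positivity) (hx j), sum_appendWeight x⟩

/-- When all weights exceed `1 / (k + 1)`, moving each by at most `D` multiplies it by at most `1 +
(k + 1) D`, and `log (1 + u) ≤ u`. -/
theorem Generates.lipschitzOnWith_inChart {m : ℕ} {φ : openSimplex (m + 1) → ℝ}
    {π : openSimplex (m + 1) → stdSimplex ℝ (Fin (m + 1))} (h : Generates φ π) (k : ℕ) :
    LipschitzOnWith ((k + 1) * (m + 1)) (inChart φ) (chartInterior m k) := by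
  have key : ∀ x ∈ chartInterior m k, ∀ y ∈ chartInterior m k,
      inChart φ x - inChart φ y ≤ (k + 1) * (m + 1) * dist x y := by
    intro x hx y hy
    rw [inChart, inChart, dif_pos (appendWeight_mem hx), dif_pos (appendWeight_mem hy)]
    have hd : 0 ≤ dist x y := dist_nonneg
    set D : ℝ := (m + 1) * dist x y with hD
    have hD0 : 0 ≤ D := by positivity
    have hk : (0 : ℝ) < k + 1 := by positivity
    have hr : 0 < 1 + (k + 1) * D := by positivity
    refine (h.sub_le_log hr fun j => ?_).trans ?_
    · have h1 := (abs_le.1 (abs_appendWeight_sub_le x y j)).2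
      have h2 := hy j
      rw [div_lt_iff₀ hk] at h2
      simp only
      nlinarith [mul_le_mul_of_nonneg_left h2.le hD0]
    · have := Real.log_le_sub_one_of_pos hr
      rw [mul_assoc, ← hD]
      linarith
  refine LipschitzOnWith.of_dist_le_mul fun x hx y hy => ?_
  rw [Real.dist_eq, abs_le]
  push_cast
  have h2 := key y hy x hx
  rw [dist_comm] at h2
  exact ⟨by linarith, key x hx y hy⟩

/-- Rademacher's theorem on each `chartInterior m k`, which together exhaust the simplex, followed
by the chain rule along a line. The null set of `p` works for all directions `q`, so it can later be
used with only the first coordinate of a pair. -/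
theorem Generates.ae_hasDerivAt_slide {φ : openSimplex n → ℝ}
    {π : openSimplex n → stdSimplex ℝ (Fin n)} (h : Generates φ π) :
    ∀ᵐ p ∂simplexVolume n, ∀ q, ∃ d, HasDerivAt (fun s => φ (slide (p, q) s)) d 0 := by
  cases n with
  | zero => exact Eventually.of_forall fun p => absurd p.2.2 (by simp)
  | succ m =>
    have hae : ∀ᵐ x : Fin m → ℝ, ∀ k : ℕ, x ∈ chartInterior m k →
        DifferentiableWithinAt ℝ (inChart φ) (chartInterior m k) x :=
      ae_all_iff.2 fun k => (h.lipschitzOnWith_inChart k).ae_differentiableWithinAt_of_mem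
    have hae' : ∀ᵐ p ∂simplexVolume (m + 1), ∀ k : ℕ, simplexChart (m + 1) p ∈ chartInterior m k →
        DifferentiableWithinAt ℝ (inChart φ) (chartInterior m k) (simplexChart (m + 1) p) := by
      rw [ae_iff] at hae ⊢
      refine le_antisymm ?_ (zero_le)
      rw [← hae]
      -- The preimage under the chart sees only the part of the exceptional set inside the range of
      -- the chart.
      refine le_trans (le_of_eq ?_) (measure_mono (inter_subset_left
        (t := range (simplexChart (m + 1)))))
      exact (measurableEmbedding_simplexChart (m + 1)).comap_preimage volume
        {x : Fin m → ℝ | ¬∀ k : ℕ, x ∈ chartInterior m k →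
          DifferentiableWithinAt ℝ (inChart φ) (chartInterior m k) x}
    filter_upwards [hae'] with p hp q
    have hline := appendWeight_line p q
    obtain ⟨k, hk⟩ : ∃ k : ℕ, ∀ j, 1 / ((k : ℝ) + 1) < p.1 j := by
      have : ∀ j, ∀ᶠ k : ℕ in atTop, 1 / ((k : ℝ) + 1) < p.1 j := fun j =>
        tendsto_one_div_add_atTop_nhds_zero_nat.eventually (gt_mem_nhds (p.2.1 j))
      exact (eventually_all.2 this).exists
    have hmem : simplexChart (m + 1) p ∈ chartInterior m k := by
      intro j
      have := congrFun (hline 0) j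
      simp only [zero_smul, add_zero, zero_mul] at this
      rw [this]
      exact hk j
    have hd := (hp k hmem).differentiableAt ((isOpen_chartInterior m k).mem_nhds hmem)
    set c := simplexChart (m + 1) p with hc
    set v := simplexChart (m + 1) q - c with hv
    have hl : HasDerivAt (fun s : ℝ => c + s • v) v 0 := by
      simpa using ((hasDerivAt_id (0 : ℝ)).smul_const v).const_add c
    have hd' : HasFDerivAt (inChart φ) (fderiv ℝ (inChart φ) c) (c + (0 : ℝ) • v) := by
      simpa using hd.hasFDerivAt
    refine ⟨_, (hd'.comp_hasDerivAt (0 : ℝ) hl).congr_of_eventuallyEq ?_⟩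
    have hpos : ∀ᶠ s : ℝ in 𝓝 0, ∀ i, 0 < p.1 i + s * (q.1 i - p.1 i) := by
      refine eventually_all.2 fun i => ?_
      have hcont : Continuous fun s : ℝ => p.1 i + s * (q.1 i - p.1 i) := by fun_prop
      exact hcont.continuousAt.eventually (lt_mem_nhds (by simpa using p.2.1 i))
    filter_upwards [hpos] with s hs
    have hval := slide_val (x := (p, q)) hs
    have heq : appendWeight (c + s • v) = (slide (p, q) s).1 := by rw [hval]; exact hline s
    have hm : appendWeight (c + s • v) ∈ openSimplex (m + 1) := heq ▸ (slide (p, q) s).2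
    simp only [Function.comp_apply]
    rw [inChart, dif_pos hm]
    exact congrArg φ (Subtype.ext heq.symm)

/-! ### Bracketing log returns by bounded continuous functions -/

instance (n : ℕ) : LocallyCompactSpace (openSimplex n) := by
  have h : openSimplex n = (⋂ i, {p | 0 < p i}) ∩ {p | ∑ i, p i = 1} := by
    ext p; simp [openSimplex]
  have : IsLocallyClosed (openSimplex n) := by
    rw [h]
    refine (isOpen_iInter_of_finite fun i => isOpen_lt continuous_const
      (continuous_apply i)).isLocallyClosed.inter (IsClosed.isLocallyClosed ?_)
    exact isClosed_eq (by fun_prop) continuous_const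
  exact this.locallyCompactSpace

instance (n : ℕ) (M : ℝ) : LocallyCompactSpace (boundedPairs n M) :=
  (isClosed_boundedPairs M).isClosedEmbedding_subtypeVal.locallyCompactSpace

theorem tendsto_expSlope {φ : openSimplex n → ℝ} {x : openSimplex n × openSimplex n} {d : ℝ}
    (h : HasDerivAt (fun s => φ (slide x s)) d 0) :
    Tendsto (expSlope φ x) (𝓝[≠] 0) (𝓝 d) := by
  have h1 : HasDerivAt (fun s => Real.exp (φ (slide x s) - φ x.1)) d 0 := by
    simpa [slide_zero] using (h.sub_const (φ x.1)).exp
  refine h1.tendsto_slope.congr fun s => ?_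
  simp [slope, slide_zero, expSlope, div_eq_inv_mul]

/-- An upper (for `s < 0`) or lower (for `s > 0`) bound of the log return of the portfolio maps
generated by `exp φ`, as a bounded continuous function. -/
def logBound {M : ℝ} (hM : 1 ≤ M) {s : ℝ} (hs : |s| * M < 1) (φ : C(openSimplex n, ℝ)) :
    BoundedContinuousFunction (boundedPairs n M) ℝ :=
  BoundedContinuousFunction.ofNormedAddCommGroup
    (fun x => clampLog M (1 + expSlope φ x.1 s))
    ((continuous_clampLog (by linarith)).comp (continuous_const.add
      ((((φ.continuous.comp (continuous_slide hM hs)).sub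
        (φ.continuous.comp (continuous_fst.comp continuous_subtype_val))).rexp.sub
          continuous_const).div_const s)))
    (Real.log M) fun _ => abs_clampLog_le hM _

theorem logBound_apply {M : ℝ} (hM : 1 ≤ M) {s : ℝ} (hs : |s| * M < 1)
    (φ : C(openSimplex n, ℝ)) (x : boundedPairs n M) :
    logBound hM hs φ x = clampLog M (1 + expSlope φ x.1 s) := rfl

theorem abs_logBound_le {M : ℝ} (hM : 1 ≤ M) {s : ℝ} (hs : |s| * M < 1)
    (φ : C(openSimplex n, ℝ)) (x : boundedPairs n M) : |logBound hM hs φ x| ≤ Real.log M :=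
  abs_clampLog_le hM _

theorem continuous_logBound {M : ℝ} (hM : 1 ≤ M) {s : ℝ} (hs : |s| * M < 1) :
    Continuous fun z : C(openSimplex n, ℝ) × boundedPairs n M => logBound hM hs z.1 z.2 := by
  simp only [logBound_apply, expSlope]
  refine (continuous_clampLog (by linarith)).comp (continuous_const.add
    ((Continuous.sub (Continuous.rexp (Continuous.sub ?_ ?_)) continuous_const).div_const s))
  · exact continuous_fst.eval ((continuous_slide hM hs).comp continuous_snd)
  · exact continuous_fst.eval
      (continuous_fst.comp (continuous_subtype_val.comp continuous_snd))

/-- The log return `log ∑ π_i(p) q_i / p_i`. -/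
def logReturn (π : openSimplex n → stdSimplex ℝ (Fin n))
    (x : openSimplex n × openSimplex n) : ℝ := Real.log (payoff (π x.1).1 x.1 x.2)

theorem abs_logReturn_le {M : ℝ} (hM : 1 ≤ M) (π : openSimplex n → stdSimplex ℝ (Fin n))
    (x : boundedPairs n M) : |logReturn π x.1| ≤ Real.log M := by
  rw [logReturn, ← clampLog_of_mem (payoff_mem_Icc (by linarith) x.2 (π x.1.1).2)]
  exact abs_clampLog_le hM _

theorem Generates.logBound_le {M : ℝ} (hM : 1 ≤ M) {s : ℝ} (hs : |s| * M < 1)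
    {φ : C(openSimplex n, ℝ)} {π : openSimplex n → stdSimplex ℝ (Fin n)} (h : Generates φ π)
    (hpos : 0 < s) (x : boundedPairs n M) : logBound hM hs φ x ≤ logReturn π x.1 := by
  have hM0 : 0 < M := by linarith
  rw [logReturn, ← clampLog_of_mem (payoff_mem_Icc hM0 x.2 (π x.1.1).2)]
  exact clampLog_mono hM0 (h.expSlope_le hpos (slide_pos x.2 hs hM))

theorem Generates.le_logBound {M : ℝ} (hM : 1 ≤ M) {s : ℝ} (hs : |s| * M < 1)
    {φ : C(openSimplex n, ℝ)} {π : openSimplex n → stdSimplex ℝ (Fin n)} (h : Generates φ π)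
    (hneg : s < 0) (x : boundedPairs n M) : logReturn π x.1 ≤ logBound hM hs φ x := by
  have hM0 : 0 < M := by linarith
  rw [logReturn, ← clampLog_of_mem (payoff_mem_Icc hM0 x.2 (π x.1.1).2)]
  exact clampLog_mono hM0 (h.le_expSlope hneg (slide_pos x.2 hs hM))

/-- At a point of differentiability both difference quotients tend to the same derivative;
truncation supplies the dominating constant `2 log M`. -/
theorem exists_integral_logBound_sub_lt {M : ℝ} (hM : 1 ≤ M) (Q : Measure (boundedPairs n M))
    [IsProbabilityMeasure Q] {φ : C(openSimplex n, ℝ)}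
    (hQ : ∀ᵐ x ∂Q, ∃ d, HasDerivAt (fun s => φ (slide x.1 s)) d 0) {ε : ℝ} (hε : 0 < ε) :
    ∃ s : ℝ, 0 < s ∧ ∃ (hs : |s| * M < 1) (hs' : |-s| * M < 1),
      ∫ x, (logBound hM hs' φ x - logBound hM hs φ x) ∂Q < ε := by
  have hM0 : 0 < M := by linarith
  -- The index is shifted by one because the first term `M⁻¹` would violate the strict bound `|s| *
  -- M < 1`.
  let h : ℕ → ℝ := fun k => M⁻¹ * (1 / ((k + 1 : ℕ) + 1 : ℝ))
  have hpos : ∀ k, 0 < h k := fun k => by positivity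
  have hlt : ∀ k, |h k| * M < 1 := fun k => by
    have : h k * M = 1 / ((k + 1 : ℕ) + 1 : ℝ) := by simp only [h]; field_simp
    rw [abs_of_pos (hpos k), this, div_lt_one (by positivity)]
    push_cast
    linarith [Nat.cast_nonneg (α := ℝ) k]
  have hlt' : ∀ k, |-h k| * M < 1 := fun k => by rw [abs_neg]; exact hlt k
  have h0 : Tendsto h atTop (𝓝 0) := by
    have : Tendsto (fun k : ℕ => (1 / ((k + 1 : ℕ) + 1 : ℝ))) atTop (𝓝 0) :=
      tendsto_one_div_add_atTop_nhds_zero_nat.comp (tendsto_add_atTop_nat 1)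
    simpa only [mul_zero] using this.const_mul M⁻¹
  have hd : Tendsto (fun k => ∫ x, (logBound hM (hlt' k) φ x - logBound hM (hlt k) φ x) ∂Q) atTop
      (𝓝 (∫ _, (0 : ℝ) ∂Q)) := by
    refine tendsto_integral_of_dominated_convergence (fun _ => 2 * Real.log M) (fun k => ?_)
      (integrable_const _) (fun k => Eventually.of_forall fun x => ?_) ?_
    · exact (((logBound hM (hlt' k) φ).continuous.sub
        (logBound hM (hlt k) φ).continuous)).aestronglyMeasurable
    · rw [Real.norm_eq_abs]
      refine (abs_sub _ _).trans ?_
      linarith [abs_logBound_le hM (hlt' k) φ x, abs_logBound_le hM (hlt k) φ x]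
    · filter_upwards [hQ] with x ⟨d, hx⟩
      have h1 : Tendsto h atTop (𝓝[≠] 0) := tendsto_nhdsWithin_iff.2
        ⟨h0, Eventually.of_forall fun k => (hpos k).ne'⟩
      have h2 : Tendsto (fun k => -h k) atTop (𝓝[≠] 0) := tendsto_nhdsWithin_iff.2
        ⟨by simpa using h0.neg, Eventually.of_forall fun k => (neg_neg_of_pos (hpos k)).ne⟩
      have hl := (continuous_clampLog hM0).tendsto (1 + d)
      have t1 := hl.comp (((tendsto_expSlope hx).comp h1).const_add 1)
      have t2 := hl.comp (((tendsto_expSlope hx).comp h2).const_add 1)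
      rw [← sub_self (clampLog M (1 + d))]
      exact t2.sub t1
  rw [integral_zero] at hd
  obtain ⟨k, hk⟩ := (hd.eventually (gt_mem_nhds hε)).exists
  exact ⟨h k, hpos k, hlt k, hlt' k, hk⟩

/-- Convergence in `C(openSimplex n, ℝ)` is uniform only on compact sets. Tightness of `Q` makes the
remainder negligible, and `g` majorizes its indicator by a continuous function, to which weak
convergence applies. -/
theorem exists_cutoff {M : ℝ} (Q : Measure (boundedPairs n M)) [IsProbabilityMeasure Q] {δ : ℝ}
    (hδ : 0 < δ) : ∃ (K : Set (boundedPairs n M)) (g : BoundedContinuousFunction _ ℝ),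
      IsCompact K ∧ (∀ x, 0 ≤ g x) ∧ (∀ x ∉ K, g x = 1) ∧ ∫ x, g x ∂Q ≤ δ := by
  obtain ⟨K, hK, hQK⟩ := isTightMeasureSet_iff_exists_isCompact_measure_compl_le.1
    (isTightMeasureSet_singleton_of_innerRegular (μ := Q)) (ENNReal.ofReal δ)
    (ENNReal.ofReal_pos.2 hδ)
  replace hQK := hQK Q rfl
  obtain ⟨f, hf1, hf2, -, hf⟩ := exists_continuousMap_one_of_isCompact_subset_isOpen hK isOpen_univ
    (subset_univ K)
  let g : BoundedContinuousFunction (boundedPairs n M) ℝ :=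
    BoundedContinuousFunction.ofNormedAddCommGroup (fun x => 1 - f x)
      (continuous_const.sub f.continuous) 1 fun x => by
        rw [Real.norm_eq_abs, abs_le]; constructor <;> linarith [(hf x).1, (hf x).2]
  have hg : ∀ x, g x = 1 - f x := fun _ => rfl
  refine ⟨tsupport f, g, hf2, fun x => ?_, fun x hx => ?_, ?_⟩
  · rw [hg]; linarith [(hf x).2]
  · rw [hg, image_eq_zero_of_notMem_tsupport hx, sub_zero]
  · have hle : ∀ x, g x ≤ Kᶜ.indicator (fun _ => (1 : ℝ)) x := fun x => by
      by_cases hx : x ∈ K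
      · rw [indicator_of_notMem (by simpa using hx), hg, hf1 hx]; simp
      · rw [indicator_of_mem (by simpa using hx), hg]; linarith [(hf x).1]
    calc ∫ x, g x ∂Q ≤ ∫ x, Kᶜ.indicator (fun _ => (1 : ℝ)) x ∂Q :=
          integral_mono (g.integrable Q)
            ((integrable_const _).indicator hK.measurableSet.compl) hle
      _ = Q.real Kᶜ := by
          rw [integral_indicator_const _ hK.measurableSet.compl]; simp
      _ ≤ δ := ENNReal.toReal_le_of_le_ofReal hδ.le hQK

/-- Near a given log-generating function, the log returns of all generated portfolio maps are
close, in mean, to one bounded continuous function. -/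
theorem Generates.exists_bracket {M : ℝ} (hM : 1 ≤ M) (Q : Measure (boundedPairs n M))
    [IsProbabilityMeasure Q] {φ₀ : C(openSimplex n, ℝ)}
    {π₀ : openSimplex n → stdSimplex ℝ (Fin n)} (h₀ : Generates φ₀ π₀)
    (hQ : ∀ᵐ x ∂Q, ∃ d, HasDerivAt (fun s => φ₀ (slide x.1 s)) d 0) {ε : ℝ} (hε : 0 < ε) :
    ∃ U ∈ 𝓝 φ₀, ∃ f e : BoundedContinuousFunction (boundedPairs n M) ℝ, ∫ x, e x ∂Q ≤ ε ∧
      ∀ φ ∈ U, ∀ π, Generates φ π → ∀ x : boundedPairs n M, |logReturn π x.1 - f x| ≤ e x := by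
  have hL : 0 ≤ Real.log M := Real.log_nonneg hM
  obtain ⟨s, hs0, hs, hs', hint⟩ := exists_integral_logBound_sub_lt hM Q hQ
    (show 0 < ε / 3 by linarith)
  -- The added `1` keeps the denominator positive when `M = 1`.
  obtain ⟨K, g, hK, hg0, hg1, hgint⟩ := exists_cutoff Q
    (show 0 < ε / (3 * (2 * Real.log M + 1)) by positivity)
  set a := logBound hM hs φ₀ with ha
  set b := logBound hM hs' φ₀ with hb
  have hη : 0 < ε / 3 := by linarith
  have hnear : ∀ {r : ℝ} (hr : |r| * M < 1), ∀ᶠ φ : C(openSimplex n, ℝ) in 𝓝 φ₀, ∀ x ∈ K,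
      |logBound hM hr φ x - logBound hM hr φ₀ x| < ε / 3 := by
    intro r hr
    refine hK.eventually_forall_of_forall_eventually fun x _ => ?_
    have hc := continuous_logBound (n := n) hM hr
    have hc' : Continuous fun z : C(openSimplex n, ℝ) × boundedPairs n M =>
        |logBound hM hr z.1 z.2 - logBound hM hr φ₀ z.2| :=
      (hc.sub ((logBound hM hr φ₀).continuous.comp continuous_snd)).abs
    exact hc'.continuousAt.eventually (gt_mem_nhds (by simpa using hη))
  let c : BoundedContinuousFunction (boundedPairs n M) ℝ := BoundedContinuousFunction.const _ (ε / 3)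
  -- The error adds the gap of the bracket of `φ₀`, the variation of `φ` on `K`, and off `K` the
  -- trivial bound `2 log M`.
  refine ⟨_, (hnear hs).and (hnear hs'), a, (b - a) + c + (2 * Real.log M) • g, ?_, ?_⟩
  · have h1 : ∫ x, (b x - a x + ε / 3 + 2 * Real.log M * g x) ∂Q =
        ∫ x, (b x - a x) ∂Q + ε / 3 + 2 * Real.log M * ∫ x, g x ∂Q := by
      have hba : Integrable (fun x => b x - a x) Q := (b.integrable Q).sub (a.integrable Q)
      have hbc : Integrable (fun x => b x - a x + ε / 3) Q := hba.add (integrable_const _)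
      rw [integral_add hbc ((g.integrable Q).const_mul _),
        integral_add hba (integrable_const _), integral_const_mul]
      simp
    change ∫ x, (b x - a x + ε / 3 + 2 * Real.log M * g x) ∂Q ≤ ε
    have h2 : 2 * Real.log M * ∫ x, g x ∂Q ≤ ε / 3 := by
      refine (mul_le_mul_of_nonneg_left hgint (by positivity)).trans ?_
      rw [← mul_div_assoc, div_le_div_iff₀ (by positivity) (by norm_num)]
      nlinarith
    rw [h1]
    linarith
  · rintro φ ⟨h1, h2⟩ π hπ x
    change _ ≤ b x - a x + ε / 3 + 2 * Real.log M * g x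
    have hab : a x ≤ b x :=
      (h₀.logBound_le hM hs hs0 x).trans (h₀.le_logBound hM hs' (neg_neg_of_pos hs0) x)
    by_cases hx : x ∈ K
    · have e1 := abs_lt.1 (h1 x hx)
      have e2 := abs_lt.1 (h2 x hx)
      have l1 := hπ.logBound_le hM hs hs0 x
      have l2 := hπ.le_logBound hM hs' (neg_neg_of_pos hs0) x
      have := mul_nonneg (mul_nonneg zero_le_two hL) (hg0 x)
      rw [abs_le]
      constructor <;> linarith [e1.1, e1.2, e2.1, e2.2]
    · rw [hg1 x hx]
      have l1 := abs_logReturn_le hM π x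
      have l2 := abs_logBound_le hM hs φ₀ x
      refine (abs_sub _ _).trans ?_
      linarith

/-! ### Averages along a stable market path -/

theorem integral_empiricalMeasure (μ : ℕ → openSimplex n) (t : ℕ)
    (f : BoundedContinuousFunction (openSimplex n × openSimplex n) ℝ) :
    ∫ x, f x ∂(empiricalMeasure μ t : Measure (openSimplex n × openSimplex n)) =
      (1 / (t : ℝ)) * ∑ s ∈ Finset.range t, f (μ s, μ (s + 1)) := by
  change ∫ x, f x ∂(((t : ℝ≥0)⁻¹) • ∑ s ∈ Finset.range t, Measure.dirac (μ s, μ (s + 1))) = _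
  rw [integral_smul_nnreal_measure,
    integral_finsetSum_measure fun s _ => f.integrable _]
  simp [NNReal.smul_def]

theorem IsStableMarket.tendsto_average {μ : ℕ → openSimplex n}
    {P : ProbabilityMeasure (openSimplex n × openSimplex n)} (h : IsStableMarket μ P)
    (f : BoundedContinuousFunction (openSimplex n × openSimplex n) ℝ) :
    Tendsto (fun t : ℕ => (1 / (t : ℝ)) * ∑ s ∈ Finset.range t, f (μ s, μ (s + 1))) atTop
      (𝓝 (∫ x, f x ∂(P : Measure (openSimplex n × openSimplex n)))) := by
  have := FiniteMeasure.tendsto_iff_forall_integral_tendsto.1 h.tendsto f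
  simp only [integral_empiricalMeasure] at this
  exact this

theorem BoundedReturns.exists_mem {μ : ℕ → openSimplex n} (h : BoundedReturns μ) :
    ∃ M : ℝ, 1 ≤ M ∧ ∀ s, (μ s, μ (s + 1)) ∈ boundedPairs n M := by
  obtain ⟨M, hM, h⟩ := h
  have hmem : ∀ s, (μ s, μ (s + 1)) ∈ boundedPairs n M := fun s i => by
    have hp := (μ s).2.1 i
    obtain ⟨h1, h2⟩ := h s i
    rw [div_le_div_iff₀ hM hp] at h1
    rw [div_le_iff₀ hp] at h2
    exact ⟨by simp only; linarith, h2⟩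
  -- Weights sum to one at both times, so `M < 1` is impossible: some payoff lies in `[1 / M, M]`.
  refine ⟨M, ?_, hmem⟩
  have hw : (μ 0).1 ∈ stdSimplex ℝ (Fin n) := ⟨fun i => ((μ 0).2.1 i).le, (μ 0).2.2⟩
  have := payoff_mem_Icc hM (hmem 0) hw
  by_contra hlt
  have h3 : 1 < M⁻¹ := (one_lt_inv₀ hM).2 (not_le.1 hlt)
  linarith [this.1.trans this.2]

/-- The truncated distance to `B` is a test function with zero empirical averages, so its
`P`-integral vanishes. -/
theorem ae_mem_of_isClosed {μ : ℕ → openSimplex n}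
    {P : ProbabilityMeasure (openSimplex n × openSimplex n)} (h : IsStableMarket μ P)
    {B : Set (openSimplex n × openSimplex n)} (hB : IsClosed B)
    (hμ : ∀ s, (μ s, μ (s + 1)) ∈ B) :
    ∀ᵐ x ∂(P : Measure (openSimplex n × openSimplex n)), x ∈ B := by
  let g : BoundedContinuousFunction (openSimplex n × openSimplex n) ℝ :=
    BoundedContinuousFunction.ofNormedAddCommGroup (fun x => min (Metric.infDist x B) 1)
      ((Metric.continuous_infDist_pt B).min continuous_const) 1 fun x => by
        rw [Real.norm_eq_abs, abs_of_nonneg (le_min Metric.infDist_nonneg zero_le_one)]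
        exact min_le_right _ _
  have hg : ∀ x, g x = min (Metric.infDist x B) 1 := fun _ => rfl
  have hgB : ∀ x ∈ B, g x = 0 := fun x hx => by
    rw [hg, Metric.infDist_zero_of_mem hx]; simp
  have h0 := h.tendsto_average g
  simp only [fun s => hgB _ (hμ s), Finset.sum_const_zero, mul_zero] at h0
  have hz := tendsto_nhds_unique h0 tendsto_const_nhds
  have hnn : 0 ≤ᵐ[(P : Measure (openSimplex n × openSimplex n))] g := Eventually.of_forall
    fun x => le_min Metric.infDist_nonneg zero_le_one
  rw [integral_eq_zero_iff_of_nonneg_ae hnn (g.integrable _)] at hz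
  filter_upwards [hz] with x hx
  rw [hg] at hx
  rcases min_choice (Metric.infDist x B) 1 with h1 | h1
  · rw [h1] at hx
    exact (hB.mem_iff_infDist_zero ⟨_, hμ 0⟩).2 hx
  · rw [h1] at hx
    simp at hx

/-- The brackets live only on `boundedPairs n M`, so `P` is restricted to this closed set of full
measure and test functions are extended from it by Tietze. -/
theorem IsStableMarket.exists_limit {μ : ℕ → openSimplex n}
    {P : ProbabilityMeasure (openSimplex n × openSimplex n)} (h : IsStableMarket μ P)
    {M : ℝ} (hμ : ∀ s, (μ s, μ (s + 1)) ∈ boundedPairs n M) :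
    ∃ Q : Measure (boundedPairs n M), IsProbabilityMeasure Q ∧
      (∀ f : BoundedContinuousFunction (boundedPairs n M) ℝ,
        Tendsto (fun t : ℕ => (1 / (t : ℝ)) * ∑ s ∈ Finset.range t, f ⟨_, hμ s⟩) atTop
          (𝓝 (∫ x, f x ∂Q))) ∧
      ∀ (φ : openSimplex n → ℝ) (π : openSimplex n → stdSimplex ℝ (Fin n)), Generates φ π →
        ∀ᵐ x ∂Q, ∃ d, HasDerivAt (fun s => φ (slide x.1 s)) d 0 := by
  have hB := isClosed_boundedPairs (n := n) M
  have hae := ae_mem_of_isClosed h hB hμ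
  have hmap := map_comap_subtype_coe hB.measurableSet
    (P : Measure (openSimplex n × openSimplex n))
  rw [Measure.restrict_eq_self_of_ae_mem hae] at hmap
  set Q := Measure.comap ((↑) : boundedPairs n M → openSimplex n × openSimplex n)
    (P : Measure (openSimplex n × openSimplex n)) with hQ
  have hemb := MeasurableEmbedding.subtype_coe hB.measurableSet
  refine ⟨Q, ⟨?_⟩, fun f => ?_, fun φ π hφ => ?_⟩
  · have : (Q.map Subtype.val) univ = 1 := by rw [hmap]; exact measure_univ
    rwa [hemb.map_apply, preimage_univ] at this
  · obtain ⟨g, -, hg⟩ := BoundedContinuousFunction.exists_extension_norm_eq_of_isClosedEmbedding f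
      hB.isClosedEmbedding_subtypeVal
    have hgx : ∀ x : boundedPairs n M, g x.1 = f x := fun x => congrFun hg x
    have := h.tendsto_average g
    rw [← hmap, hemb.integral_map] at this
    simp only [hgx] at this
    refine this.congr fun t => ?_
    congr 1
    exact Finset.sum_congr rfl fun s _ => hgx ⟨_, hμ s⟩
  · have h1 : ∀ᵐ x ∂(simplexVolume n).prod (simplexVolume n),
        ∀ q, ∃ d, HasDerivAt (fun s => φ (slide (x.1, q) s)) d 0 :=
      Measure.quasiMeasurePreserving_fst.ae hφ.ae_hasDerivAt_slide
    have h2 : ∀ᵐ x ∂(P : Measure (openSimplex n × openSimplex n)),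
        ∀ q, ∃ d, HasDerivAt (fun s => φ (slide (x.1, q) s)) d 0 :=
      h.absolutelyContinuous.ae_le h1
    rw [← hmap, hemb.ae_map_iff] at h2
    exact h2.mono fun x hx => hx x.1.2

/-! ### Uniform convergence of the growth rates -/

theorem value_eq_prod (μ : ℕ → openSimplex n) (π : FG n) (t : ℕ) :
    value μ π t = ∏ s ∈ Finset.range t, payoff (π.map (μ s)).1 (μ s) (μ (s + 1)) := by
  induction t with
  | zero => simp [value, relativeValue]
  | succ t ih => rw [Finset.prod_range_succ, ← ih]; rfl

theorem payoff_pos {w : Fin n → ℝ} (hw : w ∈ stdSimplex ℝ (Fin n)) (p q : openSimplex n) :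
    0 < payoff w p q := by
  have hr : ∀ i, 0 < q.1 i / p.1 i := fun i => div_pos (q.2.1 i) (p.2.1 i)
  refine lt_of_le_of_ne (Finset.sum_nonneg fun i _ => mul_nonneg (hw.1 i) (hr i).le) fun h0 => ?_
  have h1 := (Finset.sum_eq_zero_iff_of_nonneg
    fun i _ => mul_nonneg (hw.1 i) (hr i).le).1 h0.symm
  have : ∑ i, w i = 0 := Finset.sum_eq_zero fun i hi =>
    (mul_eq_zero.1 (h1 i hi)).resolve_right (hr i).ne'
  rw [hw.2] at this
  exact one_ne_zero this

theorem value_pos (μ : ℕ → openSimplex n) (π : FG n) (t : ℕ) : 0 < value μ π t := by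
  rw [value_eq_prod]
  exact Finset.prod_pos fun s _ => payoff_pos (π.map (μ s)).2 _ _

theorem logGrowth_eq (μ : ℕ → openSimplex n) (t : ℕ) (π : FG n) :
    logGrowth μ t π =
      (1 / (t : ℝ)) * ∑ s ∈ Finset.range t, logReturn π.map (μ s, μ (s + 1)) := by
  rw [logGrowth, value_eq_prod, Real.log_prod fun s _ => (payoff_pos (π.map (μ s)).2 _ _).ne']
  rfl

theorem IsStableMarket.exists_nhds_logGrowth {μ : ℕ → openSimplex n}
    {P : ProbabilityMeasure (openSimplex n × openSimplex n)} (h : IsStableMarket μ P)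
    {φ₀ : C(openSimplex n, ℝ)} {π₀ : openSimplex n → stdSimplex ℝ (Fin n)}
    (h₀ : Generates φ₀ π₀) {ε : ℝ} (hε : 0 < ε) :
    ∃ U ∈ 𝓝 φ₀, ∃ c : ℝ, ∀ᶠ t in atTop, ∀ φ ∈ U, ∀ π : FG n, Generates φ π.map →
      |logGrowth μ t π - c| < ε := by
  obtain ⟨M, hM, hμ⟩ := h.bounded.exists_mem
  obtain ⟨Q, hQ, hlim, hae⟩ := h.exists_limit hμ
  obtain ⟨U, hU, f, e, he, hfe⟩ := h₀.exists_bracket hM Q (hae _ _ h₀)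
    (show 0 < ε / 3 by linarith)
  refine ⟨U, hU, ∫ x, f x ∂Q, ?_⟩
  have h1 := (Metric.tendsto_nhds.1 (hlim f)) (ε / 3) (by linarith)
  have h2 := (hlim e).eventually (gt_mem_nhds (show ∫ x, e x ∂Q < ε * (2 / 3) by linarith))
  filter_upwards [h1, h2] with t h1 h2 φ hφ π hπ
  rw [Real.dist_eq] at h1
  have h3 : |logGrowth μ t π - (1 / (t : ℝ)) * ∑ s ∈ Finset.range t, f ⟨_, hμ s⟩| ≤
      (1 / (t : ℝ)) * ∑ s ∈ Finset.range t, e ⟨_, hμ s⟩ := by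
    rw [logGrowth_eq, ← mul_sub, ← Finset.sum_sub_distrib, abs_mul,
      abs_of_nonneg (show 0 ≤ 1 / (t : ℝ) by positivity)]
    refine mul_le_mul_of_nonneg_left ((Finset.abs_sum_le_sum_abs _ _).trans ?_) (by positivity)
    exact Finset.sum_le_sum fun s _ => hfe φ hφ _ hπ ⟨_, hμ s⟩
  have := abs_sub_le (logGrowth μ t π) ((1 / (t : ℝ)) * ∑ s ∈ Finset.range t, f ⟨_, hμ s⟩)
    (∫ x, f x ∂Q)
  linarith

/-- Finitely many of the neighbourhoods from `exists_nhds_logGrowth` cover the compact set of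
generators, so a single time threshold suffices. -/
theorem IsStableMarket.uniformCauchySeqOn {μ : ℕ → openSimplex n}
    {P : ProbabilityMeasure (openSimplex n × openSimplex n)} (h : IsStableMarket μ P) :
    UniformCauchySeqOn (logGrowth μ) atTop univ := by
  rw [Metric.uniformCauchySeqOn_iff]
  intro ε hε
  have key : ∃ T, ∀ t ≥ T, ∀ s ≥ T, ∀ φ ∈ logGenerators (μ 0), ∀ π : FG n,
      Generates φ π.map → |logGrowth μ t π - logGrowth μ s π| < ε := by
    refine (isCompact_logGenerators (μ 0)).induction_on
      (p := fun S => ∃ T, ∀ t ≥ T, ∀ s ≥ T, ∀ φ ∈ S, ∀ π : FG n, Generates φ π.map →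
        |logGrowth μ t π - logGrowth μ s π| < ε) ⟨0, by simp⟩ ?_ ?_ ?_
    · rintro S S' hS ⟨T, hT⟩
      exact ⟨T, fun t ht s hs φ hφ => hT t ht s hs φ (hS hφ)⟩
    · rintro S S' ⟨T, hT⟩ ⟨T', hT'⟩
      refine ⟨max T T', fun t ht s hs φ hφ => ?_⟩
      simp only [ge_iff_le, max_le_iff] at ht hs
      rcases hφ with hφ | hφ
      · exact hT t ht.1 s hs.1 φ hφ
      · exact hT' t ht.2 s hs.2 φ hφ
    · rintro φ₀ ⟨-, π₀, h₀⟩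
      obtain ⟨U, hU, c, hc⟩ := h.exists_nhds_logGrowth h₀ (half_pos hε)
      obtain ⟨T, hT⟩ := eventually_atTop.1 hc
      refine ⟨U, mem_nhdsWithin_of_mem_nhds hU, T, fun t ht s hs φ hφ π hπ => ?_⟩
      have h1 := hT t ht φ hφ π hπ
      have h2 := hT s hs φ hφ π hπ
      have h3 := abs_sub_le (logGrowth μ t π) c (logGrowth μ s π)
      rw [abs_sub_comm c] at h3
      linarith
  obtain ⟨T, hT⟩ := key
  refine ⟨T, fun t ht s hs π _ => ?_⟩
  obtain ⟨φ, hφ, hgen⟩ := π.exists_logGenerator (μ 0)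
  exact hT t ht s hs φ hφ π hgen

theorem IsStableMarket.tendsto_logGrowth {μ : ℕ → openSimplex n}
    {P : ProbabilityMeasure (openSimplex n × openSimplex n)} (h : IsStableMarket μ P) (π : FG n) :
    Tendsto (fun t : ℕ => logGrowth μ t π) atTop (𝓝 (growthRate μ π)) := by
  obtain ⟨l, hl⟩ := cauchySeq_tendsto_of_complete
    (h.uniformCauchySeqOn.cauchySeq (mem_univ π))
  rwa [growthRate, hl.limUnder_eq]

theorem IsStableMarket.tendstoUniformly {μ : ℕ → openSimplex n}
    {P : ProbabilityMeasure (openSimplex n × openSimplex n)} (h : IsStableMarket μ P) :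
    TendstoUniformly (logGrowth μ) (growthRate μ) atTop := by
  rw [← tendstoUniformlyOn_univ]
  exact h.uniformCauchySeqOn.tendstoUniformlyOn_of_tendsto fun π _ => h.tendsto_logGrowth π

/-! ### Continuity of `W` and exponential bounds on values -/

theorem FG.continuous_map_apply (p : openSimplex n) : Continuous fun π : FG n => π.map p :=
  (UniformFun.uniformContinuous_eval _ p).continuous.comp continuous_subtype_val

theorem continuous_payoff_map (p q : openSimplex n) :
    Continuous fun π : FG n => payoff (π.map p).1 p q :=
  continuous_finsetSum _ fun i _ => ((continuous_apply i).comp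
    (continuous_subtype_val.comp (FG.continuous_map_apply p))).mul_const _

theorem continuous_value (μ : ℕ → openSimplex n) (t : ℕ) :
    Continuous fun π : FG n => value μ π t := by
  simp only [value_eq_prod]
  exact continuous_finsetProd _ fun s _ => continuous_payoff_map _ _

theorem exists_value_le (μ : ℕ → openSimplex n) (t : ℕ) : ∃ C, ∀ π : FG n, value μ π t ≤ C := by
  refine ⟨∏ s ∈ Finset.range t, ∑ i, (μ (s + 1)).1 i / (μ s).1 i, fun π => ?_⟩
  rw [value_eq_prod]
  exact Finset.prod_le_prod (fun s _ => (payoff_pos (π.map (μ s)).2 _ _).le)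
    fun s _ => payoff_le_sum (π.map (μ s)).2 _ _

theorem continuous_logGrowth (μ : ℕ → openSimplex n) (t : ℕ) : Continuous (logGrowth μ t) :=
  ((continuous_value μ t).log fun π => (value_pos μ π t).ne').const_mul _

theorem IsStableMarket.continuous_growthRate {μ : ℕ → openSimplex n}
    {P : ProbabilityMeasure (openSimplex n × openSimplex n)} (h : IsStableMarket μ P) :
    Continuous (growthRate μ) :=
  h.tendstoUniformly.continuous (Frequently.of_forall fun t => continuous_logGrowth μ t)

theorem IsStableMarket.exists_abs_growthRate_le {μ : ℕ → openSimplex n}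
    {P : ProbabilityMeasure (openSimplex n × openSimplex n)} (h : IsStableMarket μ P) :
    ∃ C, ∀ π : FG n, |growthRate μ π| ≤ C := by
  obtain ⟨M, hM, hμ⟩ := h.bounded.exists_mem
  refine ⟨Real.log M, fun π => le_of_tendsto (h.tendsto_logGrowth π).abs
    ((eventually_ne_atTop 0).mono fun t ht => ?_)⟩
  have ht' : (t : ℝ) ≠ 0 := Nat.cast_ne_zero.2 ht
  rw [logGrowth_eq, abs_mul, abs_of_nonneg (show 0 ≤ 1 / (t : ℝ) by positivity)]
  calc (1 / (t : ℝ)) * |∑ s ∈ Finset.range t, logReturn π.map (μ s, μ (s + 1))|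
      ≤ (1 / (t : ℝ)) * ∑ _s ∈ Finset.range t, Real.log M := by
        refine mul_le_mul_of_nonneg_left ((Finset.abs_sum_le_sum_abs _ _).trans ?_) (by positivity)
        exact Finset.sum_le_sum fun s _ => abs_logReturn_le hM π.map ⟨_, hμ s⟩
    _ = Real.log M := by simp [field]

theorem IsStableMarket.eventually_value_bounds {μ : ℕ → openSimplex n}
    {P : ProbabilityMeasure (openSimplex n × openSimplex n)} (h : IsStableMarket μ P) {ε : ℝ}
    (hε : 0 < ε) : ∀ᶠ t : ℕ in atTop, ∀ π : FG n,
      Real.exp (t * (growthRate μ π - ε)) ≤ value μ π t ∧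
        value μ π t ≤ Real.exp (t * (growthRate μ π + ε)) := by
  filter_upwards [Metric.tendstoUniformly_iff.1 h.tendstoUniformly ε hε, eventually_gt_atTop 0]
    with t ht ht0 π
  have ht' : (0 : ℝ) < t := Nat.cast_pos.2 ht0
  have h1 := ht π
  have h2 : Real.log (value μ π t) = t * logGrowth μ t π := by
    rw [logGrowth, ← mul_assoc, mul_one_div_cancel ht'.ne', one_mul]
  rw [Real.dist_eq, abs_lt] at h1
  rw [← Real.le_log_iff_exp_le (value_pos μ π t), ← Real.log_le_iff_le_exp (value_pos μ π t), h2]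
  constructor <;> nlinarith [h1.1, h1.2]

/-! ### The large deviation principle -/

/-- The `ν₀`-average of the relative values over `B`. -/
def partitionMass (μ : ℕ → openSimplex n) (ν₀ : Measure (FG n)) (t : ℕ) (B : Set (FG n)) : ℝ≥0∞ :=
  ∫⁻ π in B, ENNReal.ofReal (value μ π t) ∂ν₀

theorem wealthDistribution_apply (μ : ℕ → openSimplex n) (ν₀ : Measure (FG n)) (t : ℕ)
    {B : Set (FG n)} (hB : MeasurableSet B) :
    wealthDistribution μ ν₀ t B =
      (partitionMass μ ν₀ t univ)⁻¹ * partitionMass μ ν₀ t B := by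
  rw [wealthDistribution, Measure.smul_apply, withDensity_apply _ hB, partitionMass,
    partitionMass, Measure.restrict_univ, smul_eq_mul]

theorem IsSupport.compl_null {Θ : Type*} [TopologicalSpace Θ] [MeasurableSpace Θ]
    [OpensMeasurableSpace Θ] {ν : Measure Θ} [IsProbabilityMeasure ν] {S : Set Θ}
    (h : IsSupport ν S) : ν Sᶜ = 0 :=
  (prob_compl_eq_zero_iff h.1.1.measurableSet).2 h.1.2

/-- Otherwise the complement of `G` would be a closed set of measure one missing a point of the
smallest such set. -/
theorem IsSupport.pos_of_isOpen {Θ : Type*} [TopologicalSpace Θ] [MeasurableSpace Θ]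
    [OpensMeasurableSpace Θ] {ν : Measure Θ} [IsProbabilityMeasure ν] {S : Set Θ}
    (h : IsSupport ν S) {G : Set Θ} (hG : IsOpen G) {θ : Θ} (hθ : θ ∈ S) (hθG : θ ∈ G) :
    0 < ν G := by
  refine pos_iff_ne_zero.2 fun h0 => ?_
  have : ν Gᶜ = 1 := (prob_compl_eq_one_iff hG.measurableSet).2 h0
  exact h.2 ⟨hG.isClosed_compl, this⟩ hθ hθG

theorem IsSupport.nonempty {Θ : Type*} [TopologicalSpace Θ] [MeasurableSpace Θ]
    {ν : Measure Θ} {S : Set Θ} (h : IsSupport ν S) : S.Nonempty :=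
  nonempty_of_measure_ne_zero (by rw [h.1.2]; exact one_ne_zero)

theorem IsStableMarket.eventually_partitionMass_le {μ : ℕ → openSimplex n}
    {P : ProbabilityMeasure (openSimplex n × openSimplex n)} (h : IsStableMarket μ P)
    {ν₀ : Measure (FG n)} [IsProbabilityMeasure ν₀] {S : Set (FG n)} (hS : IsSupport ν₀ S)
    {B : Set (FG n)} (hB : MeasurableSet B) {w : ℝ}
    (hw : ∀ π ∈ B, π ∈ S → growthRate μ π ≤ w) {ε : ℝ} (hε : 0 < ε) :
    ∀ᶠ t : ℕ in atTop, partitionMass μ ν₀ t B ≤ ENNReal.ofReal (Real.exp (t * (w + ε))) := by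
  filter_upwards [h.eventually_value_bounds hε] with t ht
  have hae : ∀ᵐ π ∂ν₀.restrict B, ENNReal.ofReal (value μ π t) ≤
      ENNReal.ofReal (Real.exp (t * (w + ε))) := by
    have h1 : ∀ᵐ π ∂ν₀.restrict B, π ∈ S := ae_restrict_of_ae (mem_ae_iff.2 hS.compl_null)
    filter_upwards [h1, ae_restrict_mem hB] with π hπS hπB
    refine ENNReal.ofReal_le_ofReal ((ht π).2.trans (Real.exp_le_exp.2 ?_))
    have := hw π hπB hπS
    gcongr
  calc partitionMass μ ν₀ t B ≤ ∫⁻ _ in B, ENNReal.ofReal (Real.exp (t * (w + ε))) ∂ν₀ :=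
        lintegral_mono_ae hae
    _ = ENNReal.ofReal (Real.exp (t * (w + ε))) * ν₀ B := by rw [setLIntegral_const]
    _ ≤ ENNReal.ofReal (Real.exp (t * (w + ε))) := mul_le_of_le_one_right' prob_le_one

/-- By continuity of `W`, a smaller open set `G'` around `π₀` has growth rates above `W π₀ - ε / 3`.
Another `ε / 3` pays for the uniform error, and the last one, multiplied by `t`, absorbs the
positive constant `ν₀ G'`. -/
theorem IsStableMarket.eventually_le_partitionMass {μ : ℕ → openSimplex n}
    {P : ProbabilityMeasure (openSimplex n × openSimplex n)} (h : IsStableMarket μ P)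
    {ν₀ : Measure (FG n)} [IsProbabilityMeasure ν₀] {S : Set (FG n)} (hS : IsSupport ν₀ S)
    {G : Set (FG n)} (hG : IsOpen G) {π₀ : FG n} (hπS : π₀ ∈ S) (hπG : π₀ ∈ G) {ε : ℝ}
    (hε : 0 < ε) : ∀ᶠ t : ℕ in atTop,
      ENNReal.ofReal (Real.exp (t * (growthRate μ π₀ - ε))) ≤ partitionMass μ ν₀ t G := by
  have hε3 : 0 < ε / 3 := by linarith
  let G' := G ∩ {π | growthRate μ π₀ - ε / 3 < growthRate μ π}
  have hG' : IsOpen G' := hG.inter (isOpen_lt continuous_const h.continuous_growthRate)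
  have hmem : π₀ ∈ G' := ⟨hπG, by simp only [mem_ofPred_eq]; linarith⟩
  have hpos := hS.pos_of_isOpen hG' hπS hmem
  have hreal : 0 < ν₀.real G' := ENNReal.toReal_pos hpos.ne' (measure_ne_top _ _)
  have hc : Tendsto (fun t : ℕ => (t : ℝ) * (ε / 3)) atTop atTop :=
    tendsto_natCast_atTop_atTop.atTop_mul_const hε3
  filter_upwards [h.eventually_value_bounds hε3, hc.eventually_ge_atTop (-Real.log (ν₀.real G'))]
    with t ht htc
  have hbd : Real.exp (t * (growthRate μ π₀ - ε)) ≤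
      Real.exp (t * (growthRate μ π₀ - ε / 3 - ε / 3)) * ν₀.real G' := by
    rw [← Real.log_le_log_iff (Real.exp_pos _) (mul_pos (Real.exp_pos _) hreal),
      Real.log_mul (Real.exp_pos _).ne' hreal.ne', Real.log_exp, Real.log_exp]
    linarith
  calc ENNReal.ofReal (Real.exp (t * (growthRate μ π₀ - ε)))
      ≤ ENNReal.ofReal (Real.exp (t * (growthRate μ π₀ - ε / 3 - ε / 3)) * ν₀.real G') :=
        ENNReal.ofReal_le_ofReal hbd
    _ = ∫⁻ _ in G', ENNReal.ofReal (Real.exp (t * (growthRate μ π₀ - ε / 3 - ε / 3))) ∂ν₀ := by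
        rw [setLIntegral_const, ENNReal.ofReal_mul (Real.exp_pos _).le,
          ofReal_measureReal]
    _ ≤ partitionMass μ ν₀ t G' := by
        refine setLIntegral_mono_ae' hG'.measurableSet (Eventually.of_forall fun π hπ => ?_)
        refine ENNReal.ofReal_le_ofReal (le_trans (Real.exp_le_exp.2 ?_) (ht π).1)
        have := hπ.2
        simp only [mem_ofPred_eq] at this
        gcongr
    _ ≤ partitionMass μ ν₀ t G := lintegral_mono_set inter_subset_left

theorem IsStableMarket.eventually_partitionMass_univ {μ : ℕ → openSimplex n}
    {P : ProbabilityMeasure (openSimplex n × openSimplex n)} (h : IsStableMarket μ P)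
    {ν₀ : Measure (FG n)} [IsProbabilityMeasure ν₀] {S : Set (FG n)} (hS : IsSupport ν₀ S)
    {w : ℝ} (hw : IsLUB (growthRate μ '' S) w) {ε : ℝ} (hε : 0 < ε) : ∀ᶠ t : ℕ in atTop,
      ENNReal.ofReal (Real.exp (t * (w - ε))) ≤ partitionMass μ ν₀ t univ ∧
      partitionMass μ ν₀ t univ ≤ ENNReal.ofReal (Real.exp (t * (w + ε))) := by
  obtain ⟨-, ⟨π₀, hπ₀, rfl⟩, hlt, -⟩ := hw.exists_between (show w - ε / 2 < w by linarith)
  filter_upwards [h.eventually_le_partitionMass hS isOpen_univ hπ₀ (mem_univ _) (half_pos hε),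
    h.eventually_partitionMass_le hS MeasurableSet.univ
      (fun π _ hπ => hw.1 (mem_image_of_mem _ hπ)) hε] with t h1 h2
  refine ⟨le_trans (ENNReal.ofReal_le_ofReal (Real.exp_le_exp.2 ?_)) h1, h2⟩
  exact mul_le_mul_of_nonneg_left (by linarith) (Nat.cast_nonneg t)

theorem limsup_log_div_le {u : ℕ → ℝ≥0∞} {a : ℝ}
    (h : ∀ᶠ t : ℕ in atTop, u t ≤ ENNReal.ofReal (Real.exp (t * a))) :
    limsup (fun t : ℕ => ENNReal.log (u t) / (t : EReal)) atTop ≤ a := by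
  refine limsup_le_of_le (by isBoundedDefault) ?_
  filter_upwards [h, eventually_gt_atTop 0] with t ht h0
  have ht0 : (t : ℝ) ≠ 0 := Nat.cast_ne_zero.2 h0.ne'
  have h1 := ENNReal.log_le_log ht
  rw [ENNReal.log_ofReal_of_pos (Real.exp_pos _), Real.log_exp] at h1
  refine (EReal.div_le_div_right_of_nonneg (by positivity) h1).trans (le_of_eq ?_)
  rw [show (t : EReal) = ((t : ℝ) : EReal) from rfl, ← EReal.coe_div,
    mul_div_cancel_left₀ _ ht0]

theorem le_liminf_log_div {u : ℕ → ℝ≥0∞} {a : ℝ}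
    (h : ∀ᶠ t : ℕ in atTop, ENNReal.ofReal (Real.exp (t * a)) ≤ u t) :
    a ≤ liminf (fun t : ℕ => ENNReal.log (u t) / (t : EReal)) atTop := by
  refine le_liminf_of_le (by isBoundedDefault) ?_
  filter_upwards [h, eventually_gt_atTop 0] with t ht h0
  have ht0 : (t : ℝ) ≠ 0 := Nat.cast_ne_zero.2 h0.ne'
  have h1 := ENNReal.log_le_log ht
  rw [ENNReal.log_ofReal_of_pos (Real.exp_pos _), Real.log_exp] at h1
  refine le_trans (le_of_eq ?_) (EReal.div_le_div_right_of_nonneg (by positivity) h1)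
  rw [show (t : EReal) = ((t : ℝ) : EReal) from rfl, ← EReal.coe_div,
    mul_div_cancel_left₀ _ ht0]

theorem ofReal_exp_inv_mul (a b : ℝ) :
    (ENNReal.ofReal (Real.exp a))⁻¹ * ENNReal.ofReal (Real.exp b) =
      ENNReal.ofReal (Real.exp (b - a)) := by
  rw [← ENNReal.ofReal_inv_of_pos (Real.exp_pos a), ← Real.exp_neg,
    ← ENNReal.ofReal_mul (Real.exp_pos _).le, ← Real.exp_add]
  congr 2
  ring

theorem IsStableMarket.satisfiesLDP {μ : ℕ → openSimplex n}
    {P : ProbabilityMeasure (openSimplex n × openSimplex n)} (h : IsStableMarket μ P)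
    {ν₀ : Measure (FG n)} [IsProbabilityMeasure ν₀] {S : Set (FG n)} (hS : IsSupport ν₀ S)
    {w : ℝ} (hw : IsLUB (growthRate μ '' S) w) :
    SatisfiesLDP (wealthDistribution μ ν₀) (deviationRate (growthRate μ) w S) where
  nonneg π := by
    unfold deviationRate
    split_ifs with hπ
    · exact EReal.coe_nonneg.2 (sub_nonneg.2 (hw.1 (mem_image_of_mem _ hπ)))
    · exact le_top
  lowerSemicontinuous π r hr := by
    change r < deviationRate (growthRate μ) w S π at hr
    change ∀ᶠ π' in 𝓝 π, r < deviationRate (growthRate μ) w S π'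
    by_cases hπ : π ∈ S
    · rw [deviationRate, if_pos hπ] at hr
      have hc : Continuous fun π : FG n => ((w - growthRate μ π : ℝ) : EReal) :=
        continuous_coe_real_ereal.comp (continuous_const.sub h.continuous_growthRate)
      filter_upwards [hc.continuousAt.eventually (lt_mem_nhds hr)] with π' hπ'
      unfold deviationRate
      split_ifs
      · exact hπ'
      · exact hr.trans_le le_top
    · filter_upwards [hS.1.1.isOpen_compl.mem_nhds hπ] with π' hπ'
      rw [deviationRate, if_neg hπ] at hr
      rwa [deviationRate, if_neg hπ']
  upper F hF := by
    -- Comparing with all real `r` above the bound also covers an infinite infimum, where `F` misses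
    -- `S` and the growth bound is vacuous.
    refine EReal.le_of_forall_lt_iff_le.1 fun r hr => ?_
    have hle : ∀ π ∈ F, π ∈ S → growthRate μ π ≤ w + r := by
      intro π hπF hπS
      have h1 : (⨅ θ ∈ F, deviationRate (growthRate μ) w S θ) ≤
          ((w - growthRate μ π : ℝ) : EReal) := by
        refine (biInf_le _ hπF).trans (le_of_eq ?_)
        rw [deviationRate, if_pos hπS]
      have h2 := (EReal.neg_le_neg_iff.2 h1).trans_lt hr
      rw [← EReal.coe_neg, EReal.coe_lt_coe_iff] at h2
      linarith
    refine EReal.le_of_forall_lt_iff_le.1 fun b hb => ?_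
    -- One error comes from the numerator and one from the normalization: `(w + r + ε) - (w - ε) =
    -- b`.
    have hε : 0 < (b - r) / 2 := by
      have := EReal.coe_lt_coe_iff.1 hb
      linarith
    refine limsup_log_div_le ?_
    filter_upwards [h.eventually_partitionMass_le hS hF.measurableSet hle hε,
      h.eventually_partitionMass_univ hS hw hε] with t h1 h2
    rw [wealthDistribution_apply μ ν₀ t hF.measurableSet]
    refine (mul_le_mul' (ENNReal.inv_le_inv.2 h2.1) h1).trans (le_of_eq ?_)
    rw [ofReal_exp_inv_mul]
    congr 2
    ring
  lower G hG := by
    rw [EReal.neg_le]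
    refine le_iInf₂ fun π hπG => ?_
    rw [EReal.neg_le, deviationRate]
    split_ifs with hπS
    swap
    · simp
    rw [← EReal.coe_neg]
    refine EReal.ge_of_forall_gt_iff_ge.1 fun b hb => ?_
    have hε : 0 < (growthRate μ π - w - b) / 2 := by
      have := EReal.coe_lt_coe_iff.1 hb
      linarith
    refine le_liminf_log_div ?_
    filter_upwards [h.eventually_le_partitionMass hS hG hπS hπG hε,
      h.eventually_partitionMass_univ hS hw hε] with t h1 h2
    rw [wealthDistribution_apply μ ν₀ t hG.measurableSet]
    refine le_trans (le_of_eq ?_) (mul_le_mul' (ENNReal.inv_le_inv.2 h2.2) h1)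
    rw [ofReal_exp_inv_mul]
    congr 2
    ring

theorem IsStableMarket.exists_isLUB {μ : ℕ → openSimplex n}
    {P : ProbabilityMeasure (openSimplex n × openSimplex n)} (h : IsStableMarket μ P)
    {S : Set (FG n)} (hS : S.Nonempty) : ∃ w, IsLUB (growthRate μ '' S) w := by
  obtain ⟨C, hC⟩ := h.exists_abs_growthRate_le
  refine ⟨_, isLUB_csSup (hS.image _) ⟨C, ?_⟩⟩
  rintro _ ⟨π, -, rfl⟩
  exact (abs_le.1 (hC π)).2

/-! ### Cover's portfolio and the best value -/

theorem integrable_value (μ : ℕ → openSimplex n) (ν₀ : Measure (FG n)) [IsProbabilityMeasure ν₀]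
    (t : ℕ) : Integrable (fun π => value μ π t) ν₀ := by
  obtain ⟨C, hC⟩ := exists_value_le μ t
  refine Integrable.of_bound (continuous_value μ t).aestronglyMeasurable C
    (Eventually.of_forall fun π => ?_)
  rw [Real.norm_eq_abs, abs_of_pos (value_pos μ π t)]
  exact hC π

theorem integral_value_pos (μ : ℕ → openSimplex n) (ν₀ : Measure (FG n)) [IsProbabilityMeasure ν₀]
    (t : ℕ) : 0 < ∫ π, value μ π t ∂ν₀ := by
  rw [integral_pos_iff_support_of_nonneg (fun π => (value_pos μ π t).le)
    (integrable_value μ ν₀ t)]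
  have : Function.support (fun π : FG n => value μ π t) = univ :=
    eq_univ_of_forall fun π => (value_pos μ π t).ne'
  rw [this, measure_univ]
  exact one_pos

theorem lintegral_value (μ : ℕ → openSimplex n) (ν₀ : Measure (FG n)) [IsProbabilityMeasure ν₀]
    (t : ℕ) : ∫⁻ π, ENNReal.ofReal (value μ π t) ∂ν₀ = ENNReal.ofReal (∫ π, value μ π t ∂ν₀) :=
  (ofReal_integral_eq_lintegral_ofReal (integrable_value μ ν₀ t)
    (Eventually.of_forall fun π => (value_pos μ π t).le)).symm

theorem isProbabilityMeasure_wealthDistribution (μ : ℕ → openSimplex n) (ν₀ : Measure (FG n))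
    [IsProbabilityMeasure ν₀] (t : ℕ) : IsProbabilityMeasure (wealthDistribution μ ν₀ t) := by
  have h0 : ENNReal.ofReal (∫ π, value μ π t ∂ν₀) ≠ 0 :=
    (ENNReal.ofReal_pos.2 (integral_value_pos μ ν₀ t)).ne'
  constructor
  rw [wealthDistribution, Measure.smul_apply, withDensity_apply _ MeasurableSet.univ,
    Measure.restrict_univ, lintegral_value, smul_eq_mul]
  exact ENNReal.inv_mul_cancel h0 ENNReal.ofReal_ne_top

theorem integral_wealthDistribution (μ : ℕ → openSimplex n) (ν₀ : Measure (FG n))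
    [IsProbabilityMeasure ν₀] (t : ℕ) (g : FG n → ℝ) :
    ∫ π, g π ∂(wealthDistribution μ ν₀ t) =
      (∫ π, value μ π t ∂ν₀)⁻¹ * ∫ π, value μ π t * g π ∂ν₀ := by
  rw [wealthDistribution, integral_smul_measure, lintegral_value, ENNReal.toReal_inv,
    ENNReal.toReal_ofReal (integral_value_pos μ ν₀ t).le,
    integral_withDensity_eq_integral_toReal_smul
      (continuous_value μ t).measurable.ennreal_ofReal
      (Eventually.of_forall fun _ => ENNReal.ofReal_lt_top)]
  simp only [ENNReal.toReal_ofReal (value_pos μ _ t).le, smul_eq_mul]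

theorem integrable_weights (μ : ℕ → openSimplex n) (ν₀ : Measure (FG n))
    [IsProbabilityMeasure ν₀] (t : ℕ) (i : Fin n) :
    Integrable (fun π : FG n => π.1.weights (μ t) i) (wealthDistribution μ ν₀ t) := by
  have := isProbabilityMeasure_wealthDistribution μ ν₀ t
  have hc : Continuous fun π : FG n => π.1.weights (μ t) i := (continuous_apply i).comp
    (continuous_subtype_val.comp (FG.continuous_map_apply (μ t)))
  refine Integrable.of_bound hc.aestronglyMeasurable 1 (Eventually.of_forall fun π => ?_)
  have hw : π.1.weights (μ t) ∈ stdSimplex ℝ (Fin n) := (π.map (μ t)).2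
  rw [Real.norm_eq_abs, abs_of_nonneg (hw.1 i)]
  exact (Finset.single_le_sum (fun j _ => hw.1 j) (Finset.mem_univ i)).trans_eq hw.2

theorem coverPortfolio_apply (μ : ℕ → openSimplex n) (ν₀ : Measure (FG n))
    [IsProbabilityMeasure ν₀] (t : ℕ) (i : Fin n) :
    coverPortfolio μ ν₀ t i = ∫ π, π.1.weights (μ t) i ∂(wealthDistribution μ ν₀ t) :=
  eval_integral (integrable_weights μ ν₀ t) i

theorem coverPortfolio_mem (μ : ℕ → openSimplex n) (ν₀ : Measure (FG n))
    [IsProbabilityMeasure ν₀] (t : ℕ) : coverPortfolio μ ν₀ t ∈ stdSimplex ℝ (Fin n) := by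
  have := isProbabilityMeasure_wealthDistribution μ ν₀ t
  refine ⟨fun i => ?_, ?_⟩
  · rw [coverPortfolio_apply]
    exact integral_nonneg fun π => (π.map (μ t)).2.1 i
  · simp only [coverPortfolio_apply]
    rw [← integral_finsetSum _ fun i _ => integrable_weights μ ν₀ t i]
    have : ∀ π : FG n, ∑ i, π.1.weights (μ t) i = 1 := fun π => (π.map (μ t)).2.2
    simp [this]

/-- The one-step return of the mixture is the `ν_t`-mean of the one-step returns; the normalization
of `ν_t` cancels the wealth accumulated so far. -/
theorem relativeValue_coverPortfolio (μ : ℕ → openSimplex n) (ν₀ : Measure (FG n))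
    [IsProbabilityMeasure ν₀] (t : ℕ) :
    relativeValue μ (coverPortfolio μ ν₀) t = ∫ π, value μ π t ∂ν₀ := by
  induction t with
  | zero => simp [value, relativeValue]
  | succ t ih =>
    have h1 : ∑ i, coverPortfolio μ ν₀ t i * ((μ (t + 1)).1 i / (μ t).1 i) =
        ∫ π, payoff (π.map (μ t)).1 (μ t) (μ (t + 1)) ∂(wealthDistribution μ ν₀ t) := by
      simp only [coverPortfolio_apply, ← integral_mul_const]
      rw [← integral_finsetSum _ fun i _ => (integrable_weights μ ν₀ t i).mul_const _]
      rfl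
    have h2 : ∀ π : FG n, value μ π t * payoff (π.map (μ t)).1 (μ t) (μ (t + 1)) =
        value μ π (t + 1) := fun π => rfl
    rw [relativeValue, ih, h1, integral_wealthDistribution, ← mul_assoc,
      mul_inv_cancel₀ (integral_value_pos μ ν₀ t).ne', one_mul]
    simp only [h2]

theorem tendsto_log_div_of_exp_bounds {u : ℕ → ℝ} {w : ℝ}
    (h : ∀ ε > 0, ∀ᶠ t : ℕ in atTop, Real.exp (t * (w - ε)) ≤ u t ∧
      u t ≤ Real.exp (t * (w + ε))) :
    Tendsto (fun t : ℕ => (1 / (t : ℝ)) * Real.log (u t)) atTop (𝓝 w) := by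
  refine Metric.tendsto_nhds.2 fun ε hε => ?_
  filter_upwards [h _ (half_pos hε), eventually_gt_atTop 0] with t ⟨h1, h2⟩ h0
  have ht : (0 : ℝ) < t := Nat.cast_pos.2 h0
  have hu : 0 < u t := (Real.exp_pos _).trans_le h1
  rw [← Real.le_log_iff_exp_le hu] at h1
  rw [← Real.log_le_iff_le_exp hu] at h2
  have h3 : w - ε / 2 ≤ 1 / (t : ℝ) * Real.log (u t) := by
    rw [one_div_mul_eq_div, le_div_iff₀ ht]; linarith
  have h4 : 1 / (t : ℝ) * Real.log (u t) ≤ w + ε / 2 := by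
    rw [one_div_mul_eq_div, div_le_iff₀ ht]; linarith
  rw [Real.dist_eq, abs_lt]
  constructor <;> linarith

theorem IsStableMarket.tendsto_coverPortfolio {μ : ℕ → openSimplex n}
    {P : ProbabilityMeasure (openSimplex n × openSimplex n)} (h : IsStableMarket μ P)
    {ν₀ : Measure (FG n)} [IsProbabilityMeasure ν₀] {S : Set (FG n)} (hS : IsSupport ν₀ S)
    {w : ℝ} (hw : IsLUB (growthRate μ '' S) w) :
    Tendsto (fun t : ℕ => (1 / (t : ℝ)) *
      Real.log (relativeValue μ (coverPortfolio μ ν₀) t)) atTop (𝓝 w) := by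
  refine tendsto_log_div_of_exp_bounds fun ε hε => ?_
  filter_upwards [h.eventually_partitionMass_univ hS hw hε] with t ht
  rw [partitionMass, Measure.restrict_univ, lintegral_value,
    ENNReal.ofReal_le_ofReal_iff (integral_value_pos μ ν₀ t).le,
    ENNReal.ofReal_le_ofReal_iff (Real.exp_pos _).le] at ht
  rwa [relativeValue_coverPortfolio]

theorem isLUB_bestValue [Nonempty (FG n)] (μ : ℕ → openSimplex n) (t : ℕ) :
    IsLUB (range fun π : FG n => value μ π t) (bestValue μ t) := by
  obtain ⟨C, hC⟩ := exists_value_le μ t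
  exact isLUB_ciSup ⟨C, by rintro _ ⟨π, rfl⟩; exact hC π⟩

theorem IsStableMarket.tendsto_bestValue [Nonempty (FG n)] {μ : ℕ → openSimplex n}
    {P : ProbabilityMeasure (openSimplex n × openSimplex n)} (h : IsStableMarket μ P)
    {w : ℝ} (hw : IsLUB (range (growthRate μ)) w) :
    Tendsto (fun t : ℕ => (1 / (t : ℝ)) * Real.log (bestValue μ t)) atTop (𝓝 w) := by
  refine tendsto_log_div_of_exp_bounds fun ε hε => ?_
  obtain ⟨-, ⟨π₀, rfl⟩, hlt, -⟩ := hw.exists_between (show w - ε / 2 < w by linarith)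
  filter_upwards [h.eventually_value_bounds (half_pos hε)] with t ht
  have ht0 : (0 : ℝ) ≤ t := Nat.cast_nonneg t
  constructor
  · refine le_trans (Real.exp_le_exp.2 ?_)
      ((ht π₀).1.trans ((isLUB_bestValue μ t).1 (mem_range_self π₀)))
    exact mul_le_mul_of_nonneg_left (by linarith) ht0
  · refine (isLUB_bestValue μ t).2 ?_
    rintro _ ⟨π, rfl⟩
    refine (ht π).2.trans (Real.exp_le_exp.2 (mul_le_mul_of_nonneg_left ?_ ht0))
    have := hw.1 (mem_range_self π)
    linarith

/-! ### A countable family and the atomic prior -/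

theorem convex_openSimplex (n : ℕ) : Convex ℝ (openSimplex n) := by
  rintro p ⟨hp, hp1⟩ q ⟨hq, hq1⟩ a b ha hb hab
  refine ⟨fun i => ?_, ?_⟩
  · simp only [Pi.add_apply, Pi.smul_apply, smul_eq_mul]
    rcases ha.eq_or_lt with rfl | ha'
    · have : b = 1 := by linarith
      simp [this, hq i]
    · have := mul_pos ha' (hp i)
      have := mul_nonneg hb (hq i).le
      linarith
  · simp only [Pi.add_apply, Pi.smul_apply, smul_eq_mul, Finset.sum_add_distrib, ← Finset.mul_sum,
      hp1, hq1, mul_one, hab]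

/-- The market portfolio is functionally generated. -/
instance : Nonempty (FG n) := by
  refine ⟨⟨UniformFun.ofFun fun p => ⟨p.1, fun i => (p.2.1 i).le, p.2.2⟩, fun _ => 1,
    concaveOn_const _ (convex_openSimplex n), fun _ _ => one_pos, fun p q => ?_⟩⟩
  have : ∀ i, p.1 i * (q.1 i / p.1 i) = q.1 i := fun i => mul_div_cancel₀ _ (p.2.1 i).ne'
  change (1 : ℝ) / 1 ≤ ∑ i, p.1 i * (q.1 i / p.1 i)
  simp only [this, q.2.2, div_one, le_refl]

/-- There are countably many functionally generated portfolios whose growth rates approximate those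
of all functionally generated portfolios, in all stable markets. -/
theorem exists_dense_growthRate (o : openSimplex n) :
    ∃ π : ℕ → FG n, ∀ (μ : ℕ → openSimplex n)
      (P : ProbabilityMeasure (openSimplex n × openSimplex n)), IsStableMarket μ P →
        ∀ (π₀ : FG n) (ε : ℝ), 0 < ε → ∃ k, |growthRate μ π₀ - growthRate μ (π k)| ≤ ε := by
  choose ψ _ hψ using fun π : FG n => π.exists_logGenerator o
  have hne : Nonempty (range ψ) := (range_nonempty ψ).to_subtype
  -- Density is taken among generators, not among portfolio maps, and before any market is given;
  -- only the neighbourhood `U` below depends on the market.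
  let f : ℕ → range ψ := TopologicalSpace.denseSeq (range ψ)
  choose π hπ using fun k => (f k).2
  refine ⟨π, fun μ P h π₀ ε hε => ?_⟩
  obtain ⟨U, hU, c, hc⟩ := h.exists_nhds_logGrowth (hψ π₀) (half_pos hε)
  have hU' : ((↑) : range ψ → C(openSimplex n, ℝ)) ⁻¹' U ∈ 𝓝 ⟨ψ π₀, mem_range_self π₀⟩ :=
    continuous_subtype_val.continuousAt.preimage_mem_nhds hU
  obtain ⟨-, hfU, k, rfl⟩ := mem_closure_iff_nhds.1
    ((TopologicalSpace.denseRange_denseSeq (range ψ)) ⟨ψ π₀, mem_range_self π₀⟩) _ hU'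
  have hkU : ψ (π k) ∈ U := by rw [hπ]; exact hfU
  have hlim : ∀ π' : FG n, ψ π' ∈ U → |growthRate μ π' - c| ≤ ε / 2 := fun π' hπ' =>
    le_of_tendsto ((h.tendsto_logGrowth π').sub_const c).abs
      (hc.mono fun t ht => (ht _ hπ' π' (hψ π')).le)
  have h1 := hlim π₀ (mem_of_mem_nhds hU)
  have h2 := hlim _ hkU
  refine ⟨k, (abs_sub_le _ c _).trans ?_⟩
  rw [abs_sub_comm c]
  linarith

theorem tsum_half_pow_succ : ∑' k : ℕ, (2⁻¹ : ℝ≥0∞) ^ (k + 1) = 1 := by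
  rw [ENNReal.tsum_geometric_add_one, ENNReal.one_sub_inv_two]
  exact ENNReal.mul_inv_cancel (by simp) (by simp)

theorem isProbabilityMeasure_sum_dirac {Θ : Type*} [MeasurableSpace Θ] {c : ℕ → ℝ≥0∞}
    (hc : ∑' k, c k = 1) (θ : ℕ → Θ) :
    IsProbabilityMeasure (Measure.sum fun k => c k • Measure.dirac (θ k)) :=
  ⟨by simp [Measure.sum_apply _ MeasurableSet.univ, hc]⟩

theorem isSupport_sum_dirac {Θ : Type*} [TopologicalSpace Θ] [MeasurableSpace Θ]
    [OpensMeasurableSpace Θ] {c : ℕ → ℝ≥0∞} (hc : ∑' k, c k = 1) (hpos : ∀ k, 0 < c k)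
    (θ : ℕ → Θ) :
    IsSupport (Measure.sum fun k => c k • Measure.dirac (θ k)) (closure (range θ)) := by
  have := isProbabilityMeasure_sum_dirac hc θ
  refine ⟨⟨isClosed_closure, ?_⟩, ?_⟩
  · have hmem : ∀ k, θ k ∈ closure (range θ) := fun k => subset_closure (mem_range_self k)
    rw [Measure.sum_apply _ isClosed_closure.measurableSet, ← hc]
    refine tsum_congr fun k => ?_
    rw [Measure.smul_apply, Measure.dirac_apply' _ isClosed_closure.measurableSet,
      indicator_of_mem (hmem k)]
    simp
  · rintro F ⟨hF, hF1⟩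
    refine closure_minimal ?_ hF
    rintro _ ⟨k, rfl⟩
    by_contra hk
    have h0 := (prob_compl_eq_zero_iff hF.measurableSet).2 hF1
    rw [Measure.sum_apply _ hF.measurableSet.compl, ENNReal.tsum_eq_zero] at h0
    have := h0 k
    rw [Measure.smul_apply, Measure.dirac_apply' _ hF.measurableSet.compl,
      indicator_of_mem (by exact hk)] at this
    simp [(hpos k).ne'] at this

theorem nonempty_openSimplex (hn : 2 ≤ n) : Nonempty (openSimplex n) := by
  have h : (0 : ℝ) < n := by exact_mod_cast (by omega : 0 < n)
  exact ⟨⟨fun _ => (n : ℝ)⁻¹, fun _ => inv_pos.2 h, by simp [h.ne']⟩⟩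

end UniversalPortfolio

end

open UniversalPortfolio in
theorem theorem1p3 (n : ℕ) (hn : 2 ≤ n) :
    (∀ (μ : ℕ → openSimplex n) (P : ProbabilityMeasure (openSimplex n × openSimplex n)),
      IsStableMarket μ P →
        -- (i)
        ((∀ π : FG n, Tendsto (fun t : ℕ => logGrowth μ t π) atTop (𝓝 (growthRate μ π))) ∧
          TendstoUniformly (logGrowth μ) (growthRate μ) atTop) ∧
        -- (ii)
        (∀ (ν₀ : Measure (FG n)) [IsProbabilityMeasure ν₀] (S : Set (FG n)), IsSupport ν₀ S →
          ∃ Wstar : ℝ, IsLUB (growthRate μ '' S) Wstar ∧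
            SatisfiesLDP (wealthDistribution μ ν₀) (deviationRate (growthRate μ) Wstar S))) ∧
    -- (iii)
    (∃ (ν₀ : Measure (FG n)) (S : Set (FG n)),
      IsProbabilityMeasure ν₀ ∧ IsSupport ν₀ S ∧
      (∃ (c : ℕ → ℝ≥0∞) (π : ℕ → FG n), (∀ k, 0 < c k) ∧ ∑' k, c k = 1 ∧
        ν₀ = Measure.sum (fun k => c k • Measure.dirac (π k))) ∧
      ∀ (μ : ℕ → openSimplex n) (P : ProbabilityMeasure (openSimplex n × openSimplex n)),
        IsStableMarket μ P →
          (∀ t, coverPortfolio μ ν₀ t ∈ stdSimplex ℝ (Fin n)) ∧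
          (∀ t, IsLUB (range fun π : FG n => value μ π t) (bestValue μ t)) ∧
          ∃ Wstar : ℝ, IsLUB (growthRate μ '' S) Wstar ∧ IsLUB (range (growthRate μ)) Wstar ∧
            Tendsto (fun t : ℕ => (1 / (t : ℝ)) *
              Real.log (relativeValue μ (coverPortfolio μ ν₀) t)) atTop (𝓝 Wstar) ∧
            Tendsto (fun t : ℕ => (1 / (t : ℝ)) * Real.log (bestValue μ t)) atTop (𝓝 Wstar) ∧
            Tendsto (fun t : ℕ => (1 / (t : ℝ)) *
              Real.log (relativeValue μ (coverPortfolio μ ν₀) t / bestValue μ t))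
              atTop (𝓝 0)) := by
  have : Nonempty (openSimplex n) := nonempty_openSimplex hn
  obtain ⟨π, hπ⟩ := exists_dense_growthRate (Classical.arbitrary (openSimplex n))
  refine ⟨fun μ P h => ⟨⟨h.tendsto_logGrowth, h.tendstoUniformly⟩, fun ν₀ _ S hS => ?_⟩, ?_⟩
  · obtain ⟨w, hw⟩ := h.exists_isLUB hS.nonempty
    exact ⟨w, hw, h.satisfiesLDP hS hw⟩
  let c : ℕ → ℝ≥0∞ := fun k => 2⁻¹ ^ (k + 1)
  have hc : ∀ k, 0 < c k := fun k => ENNReal.pow_pos (by simp) _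
  have hc1 : ∑' k, c k = 1 := tsum_half_pow_succ
  have hprob := isProbabilityMeasure_sum_dirac hc1 π
  have hS := isSupport_sum_dirac hc1 hc π
  refine ⟨_, _, hprob, hS, ⟨c, π, hc, hc1, rfl⟩, fun μ P h => ?_⟩
  obtain ⟨w, hw⟩ := h.exists_isLUB (univ_nonempty (α := FG n))
  rw [image_univ] at hw
  -- The atoms need not be dense in `FG n`; approximating every growth rate by those of the atoms is
  -- enough.
  have hwS : IsLUB (growthRate μ '' closure (range π)) w := by
    refine ⟨fun _ ⟨π', _, hπ'⟩ => hw.1 ⟨π', hπ'⟩, fun b hb => hw.2 ?_⟩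
    rintro _ ⟨π₀, rfl⟩
    refine le_of_forall_pos_le_add fun ε hε => ?_
    obtain ⟨k, hk⟩ := hπ μ P h π₀ ε hε
    have := hb (mem_image_of_mem _ (subset_closure (mem_range_self k)))
    linarith [(abs_le.1 hk).2]
  have hV := h.tendsto_coverPortfolio hS hwS
  have hB := h.tendsto_bestValue hw
  refine ⟨coverPortfolio_mem μ _, isLUB_bestValue μ, w, hwS, hw, hV, hB, ?_⟩
  rw [← sub_self w]
  refine (hV.sub hB).congr fun t => ?_
  have hV0 := integral_value_pos μ (Measure.sum fun k => c k • Measure.dirac (π k)) t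
  rw [← relativeValue_coverPortfolio] at hV0
  have hB0 := (value_pos μ (π 0) t).trans_le ((isLUB_bestValue μ t).1 (mem_range_self (π 0)))
  rw [Real.log_div hV0.ne' hB0.ne', mul_sub]
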